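/- Let $n\ge 2$, let $D\subset\mathbb R^n$ be a bounded open set (in particular, a bounded domain), and let $w:\mathbb R^n\to[0,\infty)$ be a weight, that is, a nonnegative locally summable function. Suppose that $w\in C^1(D)$, that $\int_D w(x)^{-n/2}\,dx<\infty$ (where $0^{-n/2}=\infty$), and that $f\in L_2(D)$. A function $u$ with weak gradient $\nabla u$ is called a weak solution of the Dirichlet problem $$\operatorname{div}(w\nabla u)=f \ \text{ in } D,\qquad u|_{\partial D}=0$$ if it belongs to the space of functions vanishing on the boundary specified below and $$\int_D w\,\nabla u\cdot\nabla\eta\,dx=-\int_D f\,\eta\,dx\qquad\text{for all }\eta\in C_0^\infty(D).$$ (a) Suppose that $w$ satisfies the Muckenhoupt $A_2$-condition $$\sup_{B}\Bigl(\frac1{|B|}\int_B w\,dx\Bigr)\Bigl(\frac1{|B|}\int_B w^{-1}\,dx\Bigr)<\infty,$$ the supremum being over all balls $B\subset\mathbb R^n$. Then the problem has a weak solution, unique up to equality almost everywhere in $D$, in the space $\overset{\circ}{W}{}^1_2(D,w)$, the closure of $C_0^\infty(D)$ in the weighted Sobolev space $W^1_2(D,w)$ with the norm $\bigl(\int_D|u|^2w\,dx\bigr)^{1/2}+\bigl(\int_D|\nabla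 u|^2w\,dx\bigr)^{1/2}$. (b) Without the $A_2$-condition, the problem has a weak solution, unique up to equality almost everywhere in $D$, in the closure of $C_0^\infty(D)$ with respect to the norm of the inner product $\langle u,v\rangle=\int_D\nabla u\cdot\nabla v\,w\,dx$, that is, among the locally summable functions $u$ on $D$ with weak gradient in $L_2(D,w)$ for which there are $\varphi_k\in C_0^\infty(D)$ with $\int_D|\nabla\varphi_k-\nabla u|^2w\,dx\to0$ and $\varphi_k\to u$ in $L_1(K)$ for every compact $K\subset D$. -/

import Mathlib

open MeasureTheory Filter Topology TopologicalSpace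
open scoped ENNReal NNReal Distributions Gradient

noncomputable section

namespace WeightedSobolev

variable {n : ℕ}

/-- A weight on `ℝⁿ`: a nonnegative locally summable function. -/
def IsWeight (w : EuclideanSpace ℝ (Fin n) → ℝ) : Prop :=
  (∀ x, 0 ≤ w x) ∧ LocallyIntegrable w

/-- The Muckenhoupt `A_p`-condition
`sup_B (|B|⁻¹ ∫_B w) (|B|⁻¹ ∫_B w^{1/(1-p)})^{p-1} < ∞`, the supremum being over all balls of `ℝⁿ`.
Positivity almost everywhere is listed separately because of the convention `0 * ∞ = 0`, which
would let the zero weight through. -/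
def IsMuckenhoupt (p : ℝ) (w : EuclideanSpace ℝ (Fin n) → ℝ) : Prop :=
  (∀ᵐ x, 0 < w x) ∧
  ∃ C : ℝ≥0, ∀ (x : EuclideanSpace ℝ (Fin n)) (r : ℝ), 0 < r →
    ((volume (Metric.ball x r))⁻¹ * ∫⁻ y in Metric.ball x r, ENNReal.ofReal (w y)) *
      ((volume (Metric.ball x r))⁻¹ *
        ∫⁻ y in Metric.ball x r, ENNReal.ofReal (w y) ^ (1 / (1 - p))) ^ (p - 1) ≤ C

/-- The measure `w(x) dx` on `D`; the weighted space `L_2(D, w)` consists of the functions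
satisfying `MemLp u 2 (weightedMeasure D w)`. -/
def weightedMeasure (D : Opens (EuclideanSpace ℝ (Fin n))) (w : EuclideanSpace ℝ (Fin n) → ℝ) :
    Measure (EuclideanSpace ℝ (Fin n)) :=
  (volume.restrict (D : Set (EuclideanSpace ℝ (Fin n)))).withDensity
    (fun x => ENNReal.ofReal (w x))

/-- The locally summable vector field `g` is the weak gradient on `D` of the locally summable
function `u`. -/
def HasWeakGradient (D : Opens (EuclideanSpace ℝ (Fin n))) (u : EuclideanSpace ℝ (Fin n) → ℝ)
    (g : EuclideanSpace ℝ (Fin n) → EuclideanSpace ℝ (Fin n)) : Prop :=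
  LocallyIntegrableOn u (D : Set (EuclideanSpace ℝ (Fin n))) ∧
  LocallyIntegrableOn g (D : Set (EuclideanSpace ℝ (Fin n))) ∧
  ∀ η : 𝓓(D, ℝ), ∫ x in (D : Set (EuclideanSpace ℝ (Fin n))), u x • ∇ (⇑η) x =
    -∫ x in (D : Set (EuclideanSpace ℝ (Fin n))), η x • g x

/-- The norm of `W^1_2(D, w)` of a function `u` with weak gradient `g`:
`(∫_D |u|² w)^{1/2} + (∫_D |g|² w)^{1/2}`. -/
def sobolevNorm (D : Opens (EuclideanSpace ℝ (Fin n))) (w u : EuclideanSpace ℝ (Fin n) → ℝ)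
    (g : EuclideanSpace ℝ (Fin n) → EuclideanSpace ℝ (Fin n)) : ℝ≥0∞ :=
  eLpNorm u 2 (weightedMeasure D w) + eLpNorm g 2 (weightedMeasure D w)

/-- `u` lies in the closure of the test functions `C_0^∞(D)` in the weighted Sobolev space
`W^1_2(D, w)`. -/
def MemSobolevZero (D : Opens (EuclideanSpace ℝ (Fin n)))
    (w u : EuclideanSpace ℝ (Fin n) → ℝ) : Prop :=
  ∃ g : EuclideanSpace ℝ (Fin n) → EuclideanSpace ℝ (Fin n),
    HasWeakGradient D u g ∧
    MemLp u 2 (weightedMeasure D w) ∧ MemLp g 2 (weightedMeasure D w) ∧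
    ∃ φ : ℕ → 𝓓(D, ℝ),
      Tendsto (fun k => sobolevNorm D w (fun x => φ k x - u x) (fun x => ∇ (⇑(φ k)) x - g x))
        atTop (𝓝 0)

/-- `u` lies in the closure of the test functions `C_0^∞(D)` for the norm of the inner product
`⟨u, v⟩ = ∫_D ∇u · ∇v w dx`: the gradients of the approximating test functions converge in
`L_2(D, w)`, and the functions themselves converge in `L_1` on compact subsets of `D`. -/
def MemEnergyClosure (D : Opens (EuclideanSpace ℝ (Fin n)))
    (w u : EuclideanSpace ℝ (Fin n) → ℝ) : Prop :=
  ∃ g : EuclideanSpace ℝ (Fin n) → EuclideanSpace ℝ (Fin n),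
    HasWeakGradient D u g ∧ MemLp g 2 (weightedMeasure D w) ∧
    ∃ φ : ℕ → 𝓓(D, ℝ),
      Tendsto (fun k => eLpNorm (fun x => ∇ (⇑(φ k)) x - g x) 2 (weightedMeasure D w))
        atTop (𝓝 0) ∧
      ∀ K : Set (EuclideanSpace ℝ (Fin n)), IsCompact K →
        K ⊆ (D : Set (EuclideanSpace ℝ (Fin n))) →
        Tendsto (fun k => eLpNorm (fun x => φ k x - u x) 1 (volume.restrict K)) atTop (𝓝 0)

/-- `u` is a weak (distributional) solution of `div (w ∇u) = f` in `D`: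
`∫_D w ∇u · ∇η dx = - ∫_D f η dx` for all `η ∈ C_0^∞(D)`. -/
def IsWeakSolution (D : Opens (EuclideanSpace ℝ (Fin n)))
    (w f u : EuclideanSpace ℝ (Fin n) → ℝ) : Prop :=
  ∃ g : EuclideanSpace ℝ (Fin n) → EuclideanSpace ℝ (Fin n),
    HasWeakGradient D u g ∧
    LocallyIntegrableOn (fun x => w x • g x) (D : Set (EuclideanSpace ℝ (Fin n))) ∧
    ∀ η : 𝓓(D, ℝ),
      ∫ x in (D : Set (EuclideanSpace ℝ (Fin n))), w x * inner ℝ (g x) (∇ (⇑η) x) =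
        -∫ x in (D : Set (EuclideanSpace ℝ (Fin n))), f x * η x

end WeightedSobolev

end

/-!
The exponent `n/2` is the one that turns the unweighted Sobolev inequality into a coercivity
estimate for the degenerate form. With `1/p = 1/2 + 1/n`, Hölder's inequality bounds
`‖∇φ‖_{L_p(D)}` by a power of `∫_D w^{-n/2}` times `‖∇φ‖_{L_2(D,w)}` (`exists_eLpNorm_le`), and
the Sobolev conjugate of `p` is `2`, so that `‖φ‖_{L_2(D)} ≤ K ‖∇φ‖_{L_2(D,w)}` for test functions
(`exists_eLpNorm_two_le`).

For the energy closure, the functional `φ ↦ -∫_D f φ` is therefore bounded for the energy norm and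
is represented by a vector field `g` in the closure of the gradients of test functions in
`L_2(D, w)` (`exists_riesz_gradient`). If `∇φ_k → g` there, then `φ_k` converges in `L_2(D)`, `∇φ_k`
converges in `L_1(D)`, and the limit `u` of `φ_k` has weak gradient `g`. For uniqueness, the
gradient of the difference of two solutions lies in the closure of the gradients and is orthogonal
to it; hence the differences of the approximating test functions converge to `0` in energy, and
so in `L_1` on compact sets.

Under the `A_2`-condition the two closures coincide, which reduces the first half of the theorem
to the second. One inclusion follows from `w^{-1} ∈ L_1(D)` and does not need `A_2`
(`MemSobolevZero.memEnergyClosure`); the other is the weighted Poincaré inequality `‖φ‖_{L_2(D,w)}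
≤ K ‖∇φ‖_{L_2(D,w)}` (`exists_poincare`). No maximal function is needed for it: integrating `∇φ`
along rays that leave `D` bounds `|φ(x)|` by an integral over the radii `0 < t ≤ 2R` of averages
of `|∇φ|` over balls around `x` of radius `3t` (`enorm_mul_volume_le`), and an averaging operator
over balls of a single radius is bounded on the weighted `L_2`, uniformly in the radius, by the
Cauchy-Schwarz inequality and Tonelli's theorem (`lintegral_sq_lintegral_ball_le`).
-/

namespace WeightedSobolev

variable {n : ℕ} {D : Opens (EuclideanSpace ℝ (Fin n))} {w : EuclideanSpace ℝ (Fin n) → ℝ}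

/-! ### Finite measures and limits of norms -/

lemma tendsto_zero_of_le_mul {a b : ℕ → ℝ≥0∞} {K : ℝ≥0} (h : ∀ k, a k ≤ K * b k)
    (hb : Tendsto b atTop (𝓝 0)) : Tendsto a atTop (𝓝 0) :=
  tendsto_of_tendsto_of_tendsto_of_le_of_le tendsto_const_nhds
    (by simpa using ENNReal.Tendsto.const_mul hb (Or.inr (ENNReal.coe_ne_top (r := K))))
    (fun _ => zero_le) h

lemma exists_eLpNorm_one_le_of_isFiniteMeasure {α F : Type*} [MeasurableSpace α]
    [NormedAddCommGroup F] (ν : Measure α) [IsFiniteMeasure ν] {p : ℝ≥0∞} (hp : 1 ≤ p) :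
    ∃ K : ℝ≥0, ∀ g : α → F, AEStronglyMeasurable g ν → eLpNorm g 1 ν ≤ K * eLpNorm g p ν := by
  have hfin : ν Set.univ ^ (1 / (1 : ℝ≥0∞).toReal - 1 / p.toReal) < ∞ := by
    refine ENNReal.rpow_lt_top_of_nonneg ?_ (measure_ne_top _ _)
    by_cases h : p = ∞
    · simp [h]
    · have : 1 ≤ p.toReal := by simpa using (ENNReal.toReal_le_toReal (by simp) h).2 hp
      simpa using inv_le_one_of_one_le₀ this
  refine ⟨(ν Set.univ ^ (1 / (1 : ℝ≥0∞).toReal - 1 / p.toReal)).toNNReal, fun g hg => ?_⟩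
  rw [ENNReal.coe_toNNReal hfin.ne, mul_comm]
  exact eLpNorm_le_eLpNorm_mul_rpow_measure_univ hp hg

lemma isFiniteMeasure_restrict_of_isBounded
    (hD : Bornology.IsBounded (D : Set (EuclideanSpace ℝ (Fin n)))) :
    IsFiniteMeasure (volume.restrict (D : Set (EuclideanSpace ℝ (Fin n)))) :=
  ⟨by simpa using hD.measure_lt_top⟩

/-! ### Gradients of test functions -/

lemma norm_gradient (φ : EuclideanSpace ℝ (Fin n) → ℝ) (x : EuclideanSpace ℝ (Fin n)) :
    ‖∇ φ x‖ = ‖fderiv ℝ φ x‖ :=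
  (InnerProductSpace.toDual ℝ _).symm.norm_map _

lemma inner_gradient (φ : EuclideanSpace ℝ (Fin n) → ℝ) (x v : EuclideanSpace ℝ (Fin n)) :
    inner ℝ (∇ φ x) v = fderiv ℝ φ x v :=
  InnerProductSpace.toDual_symm_apply

lemma differentiable_testFunction (φ : 𝓓(D, ℝ)) : Differentiable ℝ φ :=
  φ.contDiff.differentiable (by simp)

lemma continuous_gradient (φ : 𝓓(D, ℝ)) : Continuous (∇ (⇑φ)) :=
  (InnerProductSpace.toDual ℝ _).symm.continuous.comp (φ.contDiff.continuous_fderiv (by simp))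

lemma hasCompactSupport_gradient (φ : 𝓓(D, ℝ)) : HasCompactSupport (∇ (⇑φ)) :=
  (φ.hasCompactSupport.fderiv ℝ).comp_left (map_zero (InnerProductSpace.toDual ℝ _).symm)

lemma testFunction_eq_zero (φ : 𝓓(D, ℝ)) {x : EuclideanSpace ℝ (Fin n)} (hx : x ∉ D) :
    φ x = 0 :=
  image_eq_zero_of_notMem_tsupport fun h => hx (φ.tsupport_subset h)

lemma gradient_eq_zero (φ : 𝓓(D, ℝ)) {x : EuclideanSpace ℝ (Fin n)} (hx : x ∉ D) :
    ∇ (⇑φ) x = 0 := by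
  rw [← norm_eq_zero, norm_gradient, norm_eq_zero]
  exact image_eq_zero_of_notMem_tsupport fun h =>
    hx (φ.tsupport_subset (tsupport_fderiv_subset ℝ h))

lemma memLp_top_gradient (φ : 𝓓(D, ℝ)) (μ : Measure (EuclideanSpace ℝ (Fin n))) :
    MemLp (∇ (⇑φ)) ∞ μ :=
  (continuous_gradient φ).memLp_top_of_hasCompactSupport (hasCompactSupport_gradient φ) μ

lemma gradient_add (φ ψ : 𝓓(D, ℝ)) (x : EuclideanSpace ℝ (Fin n)) :
    ∇ (⇑(φ + ψ)) x = ∇ (⇑φ) x + ∇ (⇑ψ) x := by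
  have : ⇑(φ + ψ) = ⇑φ + ⇑ψ := FunLike.coe_add _ _
  rw [this]
  simp only [gradient]
  rw [fderiv_add (differentiable_testFunction φ x) (differentiable_testFunction ψ x), map_add]

lemma gradient_smul (c : ℝ) (φ : 𝓓(D, ℝ)) (x : EuclideanSpace ℝ (Fin n)) :
    ∇ (⇑(c • φ)) x = c • ∇ (⇑φ) x := by
  have : ⇑(c • φ) = c • ⇑φ := FunLike.coe_smul _ _
  rw [this]
  simp only [gradient]
  rw [fderiv_const_smul (differentiable_testFunction φ x)]
  simp

/-! ### Weak gradients -/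

lemma integrable_smul_of_locallyIntegrableOn {g : EuclideanSpace ℝ (Fin n) → EuclideanSpace ℝ (Fin n)}
    (hg : LocallyIntegrableOn g (D : Set (EuclideanSpace ℝ (Fin n)))) (η : 𝓓(D, ℝ)) :
    Integrable (fun x => η x • g x) :=
  η.integrable_bilin (ContinuousLinearMap.lsmul ℝ ℝ) hg

/-- Weak gradients are unique almost everywhere. -/
lemma HasWeakGradient.ae_eq {u : EuclideanSpace ℝ (Fin n) → ℝ}
    {g h : EuclideanSpace ℝ (Fin n) → EuclideanSpace ℝ (Fin n)}
    (hg : HasWeakGradient D u g) (hh : HasWeakGradient D u h) :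
    g =ᵐ[volume.restrict (D : Set (EuclideanSpace ℝ (Fin n)))] h := by
  have hsub : LocallyIntegrableOn (g - h) (D : Set (EuclideanSpace ℝ (Fin n))) :=
    hg.2.1.sub hh.2.1
  have key := D.isOpen.ae_eq_zero_of_integral_contDiff_smul_eq_zero hsub (fun η h1 h2 h3 => by
    let η' : 𝓓(D, ℝ) := ⟨η, h1, h2, h3⟩
    have e1 := hg.2.2 η'
    have e2 := hh.2.2 η'
    rw [e1, neg_inj] at e2
    have e3 : ∫ x in (D : Set (EuclideanSpace ℝ (Fin n))), η x • (g - h) x = 0 := by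
      simp only [Pi.sub_apply, smul_sub]
      refine (integral_sub (integrable_smul_of_locallyIntegrableOn hg.2.1 η').integrableOn
        (integrable_smul_of_locallyIntegrableOn hh.2.1 η').integrableOn).trans ?_
      exact sub_eq_zero.2 e2
    rw [← e3, setIntegral_eq_integral_of_forall_compl_eq_zero]
    intro x hx
    rw [show η x = 0 from testFunction_eq_zero η' hx, zero_smul])
  rw [Filter.EventuallyEq, ae_restrict_iff' D.isOpen.measurableSet]
  filter_upwards [key] with x hx hxD
  exact sub_eq_zero.1 (hx hxD)

/-- The classical gradient of a test function is its weak gradient (integration by parts). -/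
lemma integral_smul_gradient (φ η : 𝓓(D, ℝ)) :
    ∫ x in (D : Set (EuclideanSpace ℝ (Fin n))), φ x • ∇ (⇑η) x =
      -∫ x in (D : Set (EuclideanSpace ℝ (Fin n))), η x • ∇ (⇑φ) x := by
  rw [setIntegral_eq_integral_of_forall_compl_eq_zero
      (fun x hx => by rw [testFunction_eq_zero φ hx, zero_smul]),
    setIntegral_eq_integral_of_forall_compl_eq_zero
      (fun x hx => by rw [testFunction_eq_zero η hx, zero_smul])]
  have i1 : Integrable (fun x => φ x • ∇ (⇑η) x) := integrable_smul_of_locallyIntegrableOn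
    ((continuous_gradient η).locallyIntegrable.locallyIntegrableOn _) φ
  have i2 : Integrable (fun x => η x • ∇ (⇑φ) x) := integrable_smul_of_locallyIntegrableOn
    ((continuous_gradient φ).locallyIntegrable.locallyIntegrableOn _) η
  refine ext_inner_right ℝ fun v => ?_
  rw [inner_neg_left, real_inner_comm, real_inner_comm v, ← integral_inner i1, ← integral_inner i2]
  have key := integral_mul_fderiv_eq_neg_fderiv_mul_of_integrable (𝕜 := ℝ) (μ := volume)
    (f := φ) (g := η) (v := v) ?_ ?_ ?_ 
    (fun x _ => differentiable_testFunction φ x) (fun x _ => differentiable_testFunction η x)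
  · simp only [real_inner_comm _ v, real_inner_smul_left, inner_gradient]
    rw [key]
    simp_rw [mul_comm]
  · have := i2.inner_const (𝕜 := ℝ) v
    simpa only [real_inner_smul_left, inner_gradient, mul_comm] using this
  · have := i1.inner_const (𝕜 := ℝ) v
    simpa only [real_inner_smul_left, inner_gradient] using this
  · exact (φ.continuous.mul η.continuous).integrable_of_hasCompactSupport
      φ.hasCompactSupport.mul_right

/-- Weak gradients pass to limits in `L_1(D)`. -/
lemma hasWeakGradient_of_tendsto {u : EuclideanSpace ℝ (Fin n) → ℝ}
    {g : EuclideanSpace ℝ (Fin n) → EuclideanSpace ℝ (Fin n)} {φ : ℕ → 𝓓(D, ℝ)}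
    (hu : IntegrableOn u (D : Set (EuclideanSpace ℝ (Fin n))))
    (hg : IntegrableOn g (D : Set (EuclideanSpace ℝ (Fin n))))
    (hφu : Tendsto (fun k => eLpNorm (fun x => φ k x - u x) 1
      (volume.restrict (D : Set (EuclideanSpace ℝ (Fin n))))) atTop (𝓝 0))
    (hφg : Tendsto (fun k => eLpNorm (fun x => ∇ (⇑(φ k)) x - g x) 1
      (volume.restrict (D : Set (EuclideanSpace ℝ (Fin n))))) atTop (𝓝 0)) :
    HasWeakGradient D u g := by
  refine ⟨hu.locallyIntegrableOn, hg.locallyIntegrableOn, fun η => ?_⟩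
  set ν := volume.restrict (D : Set (EuclideanSpace ℝ (Fin n)))
  have iu : ∀ v : EuclideanSpace ℝ (Fin n) → ℝ, Integrable v ν →
      Integrable (fun x => v x • ∇ (⇑η) x) ν := fun v hv => by
    rw [← memLp_one_iff_integrable] at hv ⊢
    exact (memLp_top_gradient η ν).smul hv
  have ig : ∀ v : EuclideanSpace ℝ (Fin n) → EuclideanSpace ℝ (Fin n), Integrable v ν →
      Integrable (fun x => η x • v x) ν := fun v hv => by
    rw [← memLp_one_iff_integrable] at hv ⊢
    exact hv.smul η.memLp_top
  have iφ : ∀ k, Integrable (φ k) ν := fun k =>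
    ((φ k).continuous.integrable_of_hasCompactSupport (φ k).hasCompactSupport).integrableOn
  have iφ' : ∀ k, Integrable (∇ (⇑(φ k))) ν := fun k =>
    ((continuous_gradient (φ k)).integrable_of_hasCompactSupport
      (hasCompactSupport_gradient (φ k))).integrableOn
  have t1 : Tendsto (fun k => ∫ x, φ k x • ∇ (⇑η) x ∂ν) atTop (𝓝 (∫ x, u x • ∇ (⇑η) x ∂ν)) := by
    refine tendsto_integral_of_L1 _ (iu u hu).1 (.of_forall fun k => iu _ (iφ k)) ?_
    refine tendsto_of_tendsto_of_tendsto_of_le_of_le tendsto_const_nhds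
      (h := fun k => eLpNorm (fun x => φ k x - u x) 1 ν * eLpNorm (∇ (⇑η)) ∞ ν) ?_
      (fun _ => zero_le) (fun k => ?_)
    · simpa using ENNReal.Tendsto.mul_const hφu (Or.inr (memLp_top_gradient η ν).2.ne)
    · rw [← eLpNorm_one_eq_lintegral_enorm]
      have h : AEStronglyMeasurable (fun x => φ k x - u x) ν := (iφ k).1.sub hu.1
      have h' : AEStronglyMeasurable (∇ (⇑η)) ν := (continuous_gradient η).aestronglyMeasurable
      have := eLpNorm_smul_le_mul_eLpNorm (p := 1) (q := ∞) (r := 1) h' h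
      simp_rw [← sub_smul]
      exact this
  have t2 : Tendsto (fun k => ∫ x, η x • ∇ (⇑(φ k)) x ∂ν) atTop (𝓝 (∫ x, η x • g x ∂ν)) := by
    refine tendsto_integral_of_L1 _ (ig g hg).1 (.of_forall fun k => ig _ (iφ' k)) ?_
    refine tendsto_of_tendsto_of_tendsto_of_le_of_le tendsto_const_nhds
      (h := fun k => eLpNorm η ∞ ν * eLpNorm (fun x => ∇ (⇑(φ k)) x - g x) 1 ν) ?_
      (fun _ => zero_le) (fun k => ?_)
    · simpa using ENNReal.Tendsto.const_mul hφg (Or.inr η.memLp_top.2.ne)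
    · rw [← eLpNorm_one_eq_lintegral_enorm]
      have h : AEStronglyMeasurable (fun x => ∇ (⇑(φ k)) x - g x) ν := (iφ' k).1.sub hg.1
      have h' : AEStronglyMeasurable η ν := η.continuous.aestronglyMeasurable
      have := eLpNorm_smul_le_mul_eLpNorm (p := ∞) (q := 1) (r := 1) h h'
      simp_rw [← smul_sub]
      exact this
  rw [funext fun k => integral_smul_gradient (φ k) η] at t1
  exact tendsto_nhds_unique t1 t2.neg

/-! ### The weighted measure -/

section Weight

lemma IsWeight.aemeasurable (hw : IsWeight w) : AEMeasurable w volume :=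
  hw.2.aestronglyMeasurable.aemeasurable

lemma isFiniteMeasure_weightedMeasure
    (hD : Bornology.IsBounded (D : Set (EuclideanSpace ℝ (Fin n)))) (hw : IsWeight w) :
    IsFiniteMeasure (weightedMeasure D w) := by
  refine isFiniteMeasure_withDensity_ofReal ?_
  have : IntegrableOn w (D : Set (EuclideanSpace ℝ (Fin n))) :=
    (hw.2.integrableOn_isCompact hD.isCompact_closure).mono_set subset_closure
  exact this.2

lemma weightedMeasure_absolutelyContinuous :
    weightedMeasure D w ≪ volume.restrict (D : Set (EuclideanSpace ℝ (Fin n))) :=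
  withDensity_absolutelyContinuous _ _

/-- Summability of `w^{-n/2}` forces the weight to be positive almost everywhere in `D`. -/
lemma ae_pos_of_lintegral_lt_top (hn : 2 ≤ n) (hw : IsWeight w)
    (hwn : ∫⁻ x in (D : Set (EuclideanSpace ℝ (Fin n))),
      ENNReal.ofReal (w x) ^ (-((n : ℝ) / 2)) < ∞) :
    ∀ᵐ x ∂(volume.restrict (D : Set (EuclideanSpace ℝ (Fin n)))), 0 < w x := by
  have hm : AEMeasurable (fun x => ENNReal.ofReal (w x) ^ (-((n : ℝ) / 2)))
      (volume.restrict (D : Set (EuclideanSpace ℝ (Fin n)))) :=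
    (hw.aemeasurable.restrict.ennreal_ofReal.pow_const _)
  filter_upwards [ae_lt_top' hm hwn.ne] with x hx
  by_contra h
  have : (0 : ℝ) < n := by exact_mod_cast (by omega : 0 < n)
  rw [ENNReal.ofReal_eq_zero.2 (not_lt.1 h), ENNReal.zero_rpow_of_neg (by linarith)] at hx
  exact lt_irrefl _ hx

lemma absolutelyContinuous_weightedMeasure (hw : IsWeight w)
    (hpos : ∀ᵐ x ∂(volume.restrict (D : Set (EuclideanSpace ℝ (Fin n)))), 0 < w x) :
    volume.restrict (D : Set (EuclideanSpace ℝ (Fin n))) ≪ weightedMeasure D w := by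
  refine withDensity_absolutelyContinuous' hw.aemeasurable.restrict.ennreal_ofReal ?_
  filter_upwards [hpos] with x hx
  simpa using hx

variable {F : Type*} [NormedAddCommGroup F] [NormedSpace ℝ F]

/-- The weighted `L_2`-norm is the `L_2`-norm of the function multiplied by `w^{1/2}`. -/
lemma eLpNorm_two_weightedMeasure (hw : IsWeight w) {g : EuclideanSpace ℝ (Fin n) → F}
    (hg : AEStronglyMeasurable g (volume.restrict (D : Set (EuclideanSpace ℝ (Fin n))))) :
    eLpNorm (fun x => w x ^ (1 / 2 : ℝ) • g x) 2
      (volume.restrict (D : Set (EuclideanSpace ℝ (Fin n)))) =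
    eLpNorm g 2 (weightedMeasure D w) := by
  rw [eLpNorm_eq_lintegral_rpow_enorm_toReal (by simp) (by simp),
    eLpNorm_eq_lintegral_rpow_enorm_toReal (by simp) (by simp), weightedMeasure,
    lintegral_withDensity_eq_lintegral_mul₀ hw.aemeasurable.restrict.ennreal_ofReal
      (hg.enorm.pow_const _)]
  congr 1
  refine lintegral_congr fun x => ?_
  have h0 := hw.1 x
  simp only [ENNReal.toReal_ofNat, ENNReal.rpow_ofNat, Pi.mul_apply, enorm_smul, mul_pow]
  congr 1
  rw [Real.enorm_of_nonneg (by positivity), ← ENNReal.ofReal_pow (by positivity),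
    ← Real.rpow_natCast, ← Real.rpow_mul h0]
  norm_num

/-- Hölder's inequality: for `1/p = 1/2 + 1/n` the `L_p`-norm on `D` is controlled by the weighted
`L_2`-norm, the constant being a power of `∫_D w^{-n/2}`. -/
lemma exists_eLpNorm_le (hn : 2 ≤ n) (hw : IsWeight w)
    (hwn : ∫⁻ x in (D : Set (EuclideanSpace ℝ (Fin n))),
      ENNReal.ofReal (w x) ^ (-((n : ℝ) / 2)) < ∞)
    (p : ℝ≥0∞) (hp : p⁻¹ = (n : ℝ≥0∞)⁻¹ + 2⁻¹) :
    ∃ K : ℝ≥0, ∀ g : EuclideanSpace ℝ (Fin n) → F,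
      AEStronglyMeasurable g (volume.restrict (D : Set (EuclideanSpace ℝ (Fin n)))) →
      eLpNorm g p (volume.restrict (D : Set (EuclideanSpace ℝ (Fin n)))) ≤
        K * eLpNorm g 2 (weightedMeasure D w) := by
  set ν := volume.restrict (D : Set (EuclideanSpace ℝ (Fin n)))
  have hpos := ae_pos_of_lintegral_lt_top hn hw hwn
  have hn0 : (n : ℝ≥0∞) ≠ 0 := by simp; omega
  have hn0' : (0 : ℝ) < n := by exact_mod_cast (by omega : 0 < n)
  have hfin : eLpNorm (fun x => w x ^ (-(1 / 2) : ℝ)) n ν < ∞ := by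
    rw [eLpNorm_lt_top_iff_lintegral_rpow_enorm_lt_top hn0 (by simp)]
    refine lt_of_le_of_lt (le_of_eq ?_) hwn
    refine lintegral_congr_ae ?_
    filter_upwards [hpos] with x hx
    rw [Real.enorm_of_nonneg (by positivity), ← ENNReal.ofReal_rpow_of_pos hx, ← ENNReal.rpow_mul]
    congr 1
    simp
    ring
  have : ENNReal.HolderTriple n 2 p := ⟨hp.symm⟩
  refine ⟨(eLpNorm (fun x => w x ^ (-(1 / 2) : ℝ)) n ν).toNNReal, fun g hg => ?_⟩
  rw [ENNReal.coe_toNNReal hfin.ne, ← eLpNorm_two_weightedMeasure hw hg]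
  have hmw (s : ℝ) : AEStronglyMeasurable (fun x => w x ^ s) ν :=
    (hw.aemeasurable.restrict.pow_const _).aestronglyMeasurable
  refine le_trans (le_of_eq ?_) (eLpNorm_smul_le_mul_eLpNorm (p := n) (q := 2) (r := p)
    ((hmw _).smul hg) (hmw _))
  refine eLpNorm_congr_ae ?_
  filter_upwards [hpos] with x hx
  simp only [Pi.smul_apply']
  rw [smul_smul, ← Real.rpow_add hx]
  simp

/-- Since `n ≥ 2` and `D` is bounded, the weighted `L_2`-norm controls the `L_1`-norm on `D`. -/
lemma exists_eLpNorm_one_le (hn : 2 ≤ n)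
    (hD : Bornology.IsBounded (D : Set (EuclideanSpace ℝ (Fin n)))) (hw : IsWeight w)
    (hwn : ∫⁻ x in (D : Set (EuclideanSpace ℝ (Fin n))),
      ENNReal.ofReal (w x) ^ (-((n : ℝ) / 2)) < ∞) :
    ∃ K : ℝ≥0, ∀ g : EuclideanSpace ℝ (Fin n) → F,
      AEStronglyMeasurable g (volume.restrict (D : Set (EuclideanSpace ℝ (Fin n)))) →
      eLpNorm g 1 (volume.restrict (D : Set (EuclideanSpace ℝ (Fin n)))) ≤
        K * eLpNorm g 2 (weightedMeasure D w) := by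
  obtain ⟨K, hK⟩ := exists_eLpNorm_le (F := F) hn hw hwn ((n : ℝ≥0∞)⁻¹ + 2⁻¹)⁻¹ (inv_inv _)
  set p : ℝ≥0∞ := ((n : ℝ≥0∞)⁻¹ + 2⁻¹)⁻¹
  have hp1 : 1 ≤ p := by
    rw [ENNReal.one_le_inv, ← ENNReal.inv_two_add_inv_two]
    gcongr
    exact_mod_cast hn
  have := isFiniteMeasure_restrict_of_isBounded hD
  obtain ⟨K', hK'⟩ := exists_eLpNorm_one_le_of_isFiniteMeasure (F := F)
    (volume.restrict (D : Set (EuclideanSpace ℝ (Fin n)))) hp1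
  refine ⟨K' * K, fun g hg => (hK' g hg).trans ?_⟩
  rw [ENNReal.coe_mul, mul_assoc]
  gcongr
  exact hK g hg

/-- The energy norm controls the `L_2(D)`-norm of test functions: the exponent `p` of
`exists_eLpNorm_le` is the one whose Sobolev conjugate is `2`. -/
lemma exists_eLpNorm_two_le (hn : 2 ≤ n) (hw : IsWeight w)
    (hwn : ∫⁻ x in (D : Set (EuclideanSpace ℝ (Fin n))),
      ENNReal.ofReal (w x) ^ (-((n : ℝ) / 2)) < ∞) :
    ∃ K : ℝ≥0, ∀ φ : 𝓓(D, ℝ),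
      eLpNorm φ 2 (volume.restrict (D : Set (EuclideanSpace ℝ (Fin n)))) ≤
        K * eLpNorm (∇ (⇑φ)) 2 (weightedMeasure D w) := by
  have hn0 : (n : ℝ≥0) ≠ 0 := by simp; omega
  set p : ℝ≥0 := ((n : ℝ≥0)⁻¹ + 2⁻¹)⁻¹
  have hp1 : 1 ≤ p := by
    have h : (n : ℝ≥0)⁻¹ + 2⁻¹ ≤ 1 := by
      have h1 : (n : ℝ≥0)⁻¹ ≤ 2⁻¹ := by gcongr; exact_mod_cast hn
      calc (n : ℝ≥0)⁻¹ + 2⁻¹ ≤ 2⁻¹ + 2⁻¹ := by gcongr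
        _ = 1 := by rw [← two_mul]; simp
    exact (one_le_inv₀ (by positivity)).2 h
  have hpp : ((p : ℝ≥0∞))⁻¹ = (n : ℝ≥0∞)⁻¹ + 2⁻¹ := by
    rw [← ENNReal.coe_inv (by positivity), inv_inv, ENNReal.coe_add, ENNReal.coe_inv hn0,
      ENNReal.coe_inv (by simp)]
    simp
  obtain ⟨K, hK⟩ := exists_eLpNorm_le (F := EuclideanSpace ℝ (Fin n)) hn hw hwn p hpp
  refine ⟨eLpNormLESNormFDerivOfEqInnerConst
    (volume : Measure (EuclideanSpace ℝ (Fin n))) p * K, fun φ => ?_⟩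
  have gns := eLpNorm_le_eLpNorm_fderiv_of_eq_inner (p := p) (p' := 2)
    (volume : Measure (EuclideanSpace ℝ (Fin n)))
    (φ.contDiff.of_le (by simp)) φ.hasCompactSupport hp1
    (by rw [finrank_euclideanSpace_fin]; omega)
    (by rw [finrank_euclideanSpace_fin]; simp [p])
  have e1 : eLpNorm (fderiv ℝ φ) p volume =
      eLpNorm (∇ (⇑φ)) p (volume.restrict (D : Set (EuclideanSpace ℝ (Fin n)))) := by
    rw [eLpNorm_restrict_eq_of_support_subset]
    · exact eLpNorm_congr_norm_ae (.of_forall fun x => (norm_gradient _ x).symm)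
    · intro x hx
      by_contra h
      exact hx (gradient_eq_zero φ h)
  refine (eLpNorm_mono_measure _ Measure.restrict_le_self).trans (gns.trans ?_)
  rw [e1, ENNReal.coe_mul, mul_assoc]
  gcongr
  exact hK _ (continuous_gradient φ).aestronglyMeasurable

end Weight

/-! ### Test functions and their gradients in `L_2` -/

section Lp

variable (μ : Measure (EuclideanSpace ℝ (Fin n))) [IsFiniteMeasure μ]

lemma memLp_gradient (φ : 𝓓(D, ℝ)) : MemLp (∇ (⇑φ)) 2 μ :=
  (memLp_top_gradient φ μ).mono_exponent le_top

lemma memLp_testFunction (φ : 𝓓(D, ℝ)) : MemLp φ 2 μ :=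
  φ.memLp_top.mono_exponent le_top

/-- The map `φ ↦ ∇φ` from test functions to vector fields in `L_2(μ)`. -/
noncomputable def gradientLp : 𝓓(D, ℝ) →ₗ[ℝ] Lp (EuclideanSpace ℝ (Fin n)) 2 μ where
  toFun φ := (memLp_gradient μ φ).toLp _
  map_add' φ ψ := by
    rw [← MemLp.toLp_add]
    exact MemLp.toLp_congr _ _ (.of_forall fun x => gradient_add φ ψ x)
  map_smul' c φ := by
    rw [RingHom.id_apply, ← MemLp.toLp_const_smul]
    exact MemLp.toLp_congr _ _ (.of_forall fun x => gradient_smul c φ x)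

/-- The inclusion of the test functions in `L_2(μ)`. -/
noncomputable def testFunctionLp : 𝓓(D, ℝ) →ₗ[ℝ] Lp ℝ 2 μ where
  toFun φ := (memLp_testFunction μ φ).toLp _
  map_add' φ ψ := by
    rw [← MemLp.toLp_add]
    exact MemLp.toLp_congr _ _ (.of_forall fun x => rfl)
  map_smul' c φ := by
    rw [RingHom.id_apply, ← MemLp.toLp_const_smul]
    exact MemLp.toLp_congr _ _ (.of_forall fun x => rfl)

lemma tendsto_gradientLp_iff {g : EuclideanSpace ℝ (Fin n) → EuclideanSpace ℝ (Fin n)}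
    (hg : MemLp g 2 μ) (φ : ℕ → 𝓓(D, ℝ)) :
    Tendsto (fun k => gradientLp μ (φ k)) atTop (𝓝 (hg.toLp g)) ↔
      Tendsto (fun k => eLpNorm (fun x => ∇ (⇑(φ k)) x - g x) 2 μ) atTop (𝓝 0) :=
  Lp.tendsto_Lp_iff_tendsto_eLpNorm'' _ (fun k => memLp_gradient μ (φ k)) _ hg

variable {μ}

lemma coeFn_gradientLp (φ : 𝓓(D, ℝ)) : gradientLp μ φ =ᵐ[μ] ∇ (⇑φ) :=
  (memLp_gradient μ φ).coeFn_toLp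

lemma norm_gradientLp (φ : 𝓓(D, ℝ)) : ‖gradientLp μ φ‖ = (eLpNorm (∇ (⇑φ)) 2 μ).toReal :=
  Lp.norm_toLp _ (memLp_gradient μ φ)

lemma inner_toLp_gradientLp {g : EuclideanSpace ℝ (Fin n) → EuclideanSpace ℝ (Fin n)}
    (hg : MemLp g 2 μ) (η : 𝓓(D, ℝ)) :
    inner ℝ (hg.toLp g) (gradientLp μ η) = ∫ x, inner ℝ (g x) (∇ (⇑η) x) ∂μ := by
  rw [L2.inner_def]
  refine integral_congr_ae ?_
  filter_upwards [hg.coeFn_toLp, coeFn_gradientLp η] with x hx hx'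
  rw [hx, hx']

lemma integrable_inner_gradient {g : EuclideanSpace ℝ (Fin n) → EuclideanSpace ℝ (Fin n)}
    (hg : MemLp g 2 μ) (η : 𝓓(D, ℝ)) : Integrable (fun x => inner ℝ (g x) (∇ (⇑η) x)) μ := by
  refine (L2.integrable_inner (𝕜 := ℝ) (hg.toLp g) (gradientLp μ η)).congr ?_
  filter_upwards [hg.coeFn_toLp, coeFn_gradientLp η] with x hx hx'
  rw [hx, hx']

/-- The Riesz representation theorem in the closure of the gradients: a functional on test
functions that is bounded for the energy norm is represented by a limit of gradients. -/
lemma exists_riesz_gradient (ℓ : 𝓓(D, ℝ) →ₗ[ℝ] ℝ) (C : ℝ)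
    (hℓ : ∀ φ, ‖ℓ φ‖ ≤ C * ‖gradientLp μ φ‖) :
    ∃ g : EuclideanSpace ℝ (Fin n) → EuclideanSpace ℝ (Fin n), MemLp g 2 μ ∧
      (∃ φ : ℕ → 𝓓(D, ℝ),
        Tendsto (fun k => eLpNorm (fun x => ∇ (⇑(φ k)) x - g x) 2 μ) atTop (𝓝 0)) ∧
      ∀ η : 𝓓(D, ℝ), ∫ x, inner ℝ (g x) (∇ (⇑η) x) ∂μ = ℓ η := by
  let H := (LinearMap.range (gradientLp (D := D) μ)).topologicalClosure
  have hH : IsClosed (H : Set (Lp (EuclideanSpace ℝ (Fin n)) 2 μ)) :=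
    Submodule.isClosed_topologicalClosure _
  have : CompleteSpace H := hH.completeSpace_coe
  let e : 𝓓(D, ℝ) →ₗ[ℝ] H := (gradientLp μ).codRestrict H fun φ =>
    Submodule.le_topologicalClosure _ (LinearMap.mem_range_self _ φ)
  have he : DenseRange e := by
    intro y
    rw [Topology.IsInducing.subtypeVal.closure_eq_preimage_closure_image, Set.mem_preimage,
      ← Set.range_comp]
    exact y.2
  let G : H := (InnerProductSpace.toDual ℝ H).symm (ℓ.extendOfNorm e)
  have hG : ∀ η, inner ℝ G (e η) = ℓ η := fun η => by
    rw [InnerProductSpace.toDual_symm_apply]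
    exact LinearMap.extendOfNorm_eq he ⟨C, hℓ⟩ η
  have hg : MemLp (G : Lp (EuclideanSpace ℝ (Fin n)) 2 μ) 2 μ := Lp.memLp _
  refine ⟨(G : Lp (EuclideanSpace ℝ (Fin n)) 2 μ), hg, ?_, fun η => ?_⟩
  · obtain ⟨y, hy, hlim⟩ := mem_closure_iff_seq_limit.1 G.2
    choose φ hφ using hy
    refine ⟨φ, (tendsto_gradientLp_iff μ hg φ).1 ?_⟩
    rw [Lp.toLp_coeFn]
    exact hlim.congr fun k => (hφ k).symm
  · rw [← hG η, ← inner_toLp_gradientLp hg, Submodule.coe_inner, Lp.toLp_coeFn]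
    rfl

/-- If the energy norm controls the `L_2(ν)`-norm, test functions whose gradients converge in
`L_2(μ)` converge in `L_2(ν)`. -/
lemma exists_tendsto_of_tendsto_gradient {ν : Measure (EuclideanSpace ℝ (Fin n))}
    [IsFiniteMeasure ν] {K : ℝ≥0} (hK : ∀ φ : 𝓓(D, ℝ), eLpNorm φ 2 ν ≤ K * eLpNorm (∇ (⇑φ)) 2 μ)
    {g : EuclideanSpace ℝ (Fin n) → EuclideanSpace ℝ (Fin n)} (hg : MemLp g 2 μ)
    {φ : ℕ → 𝓓(D, ℝ)}
    (hφ : Tendsto (fun k => eLpNorm (fun x => ∇ (⇑(φ k)) x - g x) 2 μ) atTop (𝓝 0)) :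
    ∃ u : EuclideanSpace ℝ (Fin n) → ℝ, MemLp u 2 ν ∧
      Tendsto (fun k => eLpNorm (fun x => φ k x - u x) 2 ν) atTop (𝓝 0) := by
  have hc := ((tendsto_gradientLp_iff μ hg φ).2 hφ).cauchySeq
  have hb : ∀ ψ : 𝓓(D, ℝ), ‖testFunctionLp ν ψ‖ ≤ K * ‖gradientLp μ ψ‖ := fun ψ => by
    change ‖(memLp_testFunction ν ψ).toLp _‖ ≤ _
    rw [Lp.norm_toLp, norm_gradientLp]
    have := ENNReal.toReal_mono
      (ENNReal.mul_ne_top ENNReal.coe_ne_top (memLp_gradient μ ψ).2.ne) (hK ψ)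
    simpa using this
  have hc' : CauchySeq fun k => testFunctionLp ν (φ k) := by
    rw [Metric.cauchySeq_iff] at hc ⊢
    intro ε hε
    obtain ⟨N, hN⟩ := hc (ε / (K + 1)) (by positivity)
    refine ⟨N, fun i hi j hj => ?_⟩
    have h1 := hN i hi j hj
    rw [dist_eq_norm, ← map_sub] at h1 ⊢
    rw [lt_div_iff₀ (by positivity)] at h1
    nlinarith [hb (φ i - φ j), norm_nonneg (gradientLp μ (φ i - φ j))]
  obtain ⟨u, hu⟩ := cauchySeq_tendsto_of_complete hc'
  refine ⟨u, Lp.memLp u, ?_⟩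
  refine (Lp.tendsto_Lp_iff_tendsto_eLpNorm'' (fun k => ⇑(φ k))
    (fun k => memLp_testFunction ν (φ k)) _ (Lp.memLp u)).1 ?_
  rw [Lp.toLp_coeFn]
  exact hu

/-- A limit of gradients that is orthogonal to all gradients vanishes. -/
lemma ae_eq_zero_of_forall_integral_inner_eq_zero
    {g : EuclideanSpace ℝ (Fin n) → EuclideanSpace ℝ (Fin n)} (hg : MemLp g 2 μ)
    {φ : ℕ → 𝓓(D, ℝ)}
    (hφ : Tendsto (fun k => eLpNorm (fun x => ∇ (⇑(φ k)) x - g x) 2 μ) atTop (𝓝 0))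
    (h : ∀ η : 𝓓(D, ℝ), ∫ x, inner ℝ (g x) (∇ (⇑η) x) ∂μ = 0) : g =ᵐ[μ] 0 := by
  have hlim := (tendsto_gradientLp_iff μ hg φ).2 hφ
  have h1 : inner ℝ (hg.toLp g) (hg.toLp g) = 0 := by
    have hi : Tendsto (fun k => inner ℝ (hg.toLp g) (gradientLp μ (φ k))) atTop
        (𝓝 (inner ℝ (hg.toLp g) (hg.toLp g))) := tendsto_const_nhds.inner hlim
    refine tendsto_nhds_unique hi (tendsto_const_nhds.congr fun k => ?_)
    rw [inner_toLp_gradientLp, h]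
  have h2 := inner_self_eq_zero.1 h1
  exact (Lp.eq_zero_iff_ae_eq_zero.1 h2).symm.trans hg.coeFn_toLp |>.symm

end Lp

/-! ### Limits in `L_1` on compact sets -/

lemma ae_eq_of_forall_isCompact {u v : EuclideanSpace ℝ (Fin n) → ℝ}
    (h : ∀ K : Set (EuclideanSpace ℝ (Fin n)), IsCompact K →
      K ⊆ (D : Set (EuclideanSpace ℝ (Fin n))) → u =ᵐ[volume.restrict K] v) :
    u =ᵐ[volume.restrict (D : Set (EuclideanSpace ℝ (Fin n)))] v := by
  rw [Filter.EventuallyEq, ae_restrict_iff' D.isOpen.measurableSet, ae_iff]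
  refine measure_null_of_locally_null _ fun x hx => ?_
  have hxD : x ∈ D := by
    by_contra hc
    exact hx fun h => absurd h hc
  obtain ⟨r, hr, hrD⟩ := Metric.nhds_basis_closedBall.mem_iff.1 (D.isOpen.mem_nhds hxD)
  refine ⟨{a | ¬(a ∈ (D : Set (EuclideanSpace ℝ (Fin n))) → u a = v a)} ∩ Metric.closedBall x r,
    inter_mem_nhdsWithin _ (Metric.closedBall_mem_nhds x hr), ?_⟩
  have := h _ (isCompact_closedBall x r) hrD
  rw [Filter.EventuallyEq, ae_restrict_iff' measurableSet_closedBall, ae_iff] at this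
  exact measure_mono_null (fun y hy => fun hc => hy.1 fun _ => hc hy.2) this

/-- Limits in `L_1` on compact sets of two sequences with vanishing difference agree. -/
lemma ae_eq_of_tendsto_eLpNorm_one {u v : EuclideanSpace ℝ (Fin n) → ℝ} {φ ψ : ℕ → 𝓓(D, ℝ)}
    (hu : LocallyIntegrableOn u (D : Set (EuclideanSpace ℝ (Fin n))))
    (hv : LocallyIntegrableOn v (D : Set (EuclideanSpace ℝ (Fin n))))
    (hφ : ∀ K : Set (EuclideanSpace ℝ (Fin n)), IsCompact K →
      K ⊆ (D : Set (EuclideanSpace ℝ (Fin n))) →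
      Tendsto (fun k => eLpNorm (fun x => φ k x - u x) 1 (volume.restrict K)) atTop (𝓝 0))
    (hψ : ∀ K : Set (EuclideanSpace ℝ (Fin n)), IsCompact K →
      K ⊆ (D : Set (EuclideanSpace ℝ (Fin n))) →
      Tendsto (fun k => eLpNorm (fun x => ψ k x - v x) 1 (volume.restrict K)) atTop (𝓝 0))
    (hφψ : Tendsto (fun k => eLpNorm (⇑(φ k - ψ k)) 1
      (volume.restrict (D : Set (EuclideanSpace ℝ (Fin n))))) atTop (𝓝 0)) :
    u =ᵐ[volume.restrict (D : Set (EuclideanSpace ℝ (Fin n)))] v := by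
  refine ae_eq_of_forall_isCompact fun K hK hKD => ?_
  have mu := (hu.integrableOn_compact_subset hKD hK).aestronglyMeasurable
  have mv := (hv.integrableOn_compact_subset hKD hK).aestronglyMeasurable
  have mφ (k) : AEStronglyMeasurable (φ k) (volume.restrict K) :=
    (φ k).continuous.aestronglyMeasurable
  have mψ (k) : AEStronglyMeasurable (ψ k) (volume.restrict K) :=
    (ψ k).continuous.aestronglyMeasurable
  have h0 : eLpNorm (fun x => u x - v x) 1 (volume.restrict K) ≤ 0 := by
    have hlim := ((hφ K hK hKD).add hφψ).add (hψ K hK hKD)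
    rw [add_zero, add_zero] at hlim
    refine ge_of_tendsto' hlim fun k => ?_
    have e : (fun x => u x - v x) =
        ((fun x => -(φ k x - u x)) + ⇑(φ k - ψ k)) + fun x => ψ k x - v x := by
      funext x
      have : (φ k - ψ k) x = φ k x - ψ k x := rfl
      simp only [Pi.add_apply, this]
      ring
    rw [e]
    have m1 : AEStronglyMeasurable (fun x => -(φ k x - u x)) (volume.restrict K) :=
      ((mφ k).sub mu).neg
    have m2 : AEStronglyMeasurable (⇑(φ k - ψ k)) (volume.restrict K) :=
      (φ k - ψ k).continuous.aestronglyMeasurable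
    refine (eLpNorm_add_le (m1.add m2) ((mψ k).sub mv) le_rfl).trans (add_le_add_left ?_ _)
    refine (eLpNorm_add_le m1 m2 le_rfl).trans (add_le_add ?_ ?_)
    · exact (eLpNorm_neg (fun x => φ k x - u x) 1 _).le
    · exact eLpNorm_mono_measure _ (Measure.restrict_mono hKD le_rfl)
  have h1 := (eLpNorm_eq_zero_iff (mu.sub mv) one_ne_zero).1 (le_antisymm h0 zero_le)
  filter_upwards [h1] with x hx
  exact sub_eq_zero.1 hx

/-! ### The problem in the energy space -/

section Energy

lemma exists_eLpNorm_one_le_gradient (hn : 2 ≤ n)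
    (hD : Bornology.IsBounded (D : Set (EuclideanSpace ℝ (Fin n)))) (hw : IsWeight w)
    (hwn : ∫⁻ x in (D : Set (EuclideanSpace ℝ (Fin n))),
      ENNReal.ofReal (w x) ^ (-((n : ℝ) / 2)) < ∞) :
    ∃ K : ℝ≥0, ∀ φ : 𝓓(D, ℝ),
      eLpNorm φ 1 (volume.restrict (D : Set (EuclideanSpace ℝ (Fin n)))) ≤
        K * eLpNorm (∇ (⇑φ)) 2 (weightedMeasure D w) := by
  obtain ⟨K, hK⟩ := exists_eLpNorm_two_le hn hw hwn
  have := isFiniteMeasure_restrict_of_isBounded hD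
  obtain ⟨K', hK'⟩ := exists_eLpNorm_one_le_of_isFiniteMeasure (F := ℝ)
    (volume.restrict (D : Set (EuclideanSpace ℝ (Fin n)))) (p := 2) (by norm_num)
  refine ⟨K' * K, fun φ => (hK' φ φ.continuous.aestronglyMeasurable).trans ?_⟩
  rw [ENNReal.coe_mul, mul_assoc]
  gcongr
  exact hK φ

lemma setIntegral_mul_eq_integral_weightedMeasure (hw : IsWeight w)
    (h : EuclideanSpace ℝ (Fin n) → ℝ) :
    ∫ x in (D : Set (EuclideanSpace ℝ (Fin n))), w x * h x = ∫ x, h x ∂(weightedMeasure D w) := by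
  rw [weightedMeasure, integral_withDensity_eq_integral_toReal_smul₀
    hw.aemeasurable.restrict.ennreal_ofReal (.of_forall fun _ => ENNReal.ofReal_lt_top)]
  simp [ENNReal.toReal_ofReal (hw.1 _)]

/-- The right-hand side of the equation as a functional on test functions. -/
noncomputable def sourceFunctional
    {f : EuclideanSpace ℝ (Fin n) → ℝ}
    (hf : LocallyIntegrableOn f (D : Set (EuclideanSpace ℝ (Fin n)))) : 𝓓(D, ℝ) →ₗ[ℝ] ℝ where
  toFun η := -∫ x in (D : Set (EuclideanSpace ℝ (Fin n))), f x * η x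
  map_add' η ζ := by
    have i (η : 𝓓(D, ℝ)) : IntegrableOn (fun x => f x * η x)
        (D : Set (EuclideanSpace ℝ (Fin n))) := by
      simpa [mul_comm] using
        (η.integrable_bilin (ContinuousLinearMap.mul ℝ ℝ) hf).integrableOn
    have : ∀ x, f x * (η + ζ) x = f x * η x + f x * ζ x := fun x => mul_add _ _ _
    simp_rw [this]
    rw [integral_add (i η) (i ζ), neg_add]
  map_smul' c η := by
    have : ∀ x, f x * (c • η) x = c * (f x * η x) := fun x => mul_left_comm _ _ _
    simp_rw [this]
    rw [integral_const_mul, RingHom.id_apply, smul_eq_mul, mul_neg]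

variable {f : EuclideanSpace ℝ (Fin n) → ℝ}

/-- Existence in the energy space. The functional `η ↦ -∫_D f η` is bounded for the energy norm by
`exists_eLpNorm_two_le`, so that the Riesz representation theorem applies. -/
lemma exists_memEnergyClosure (hn : 2 ≤ n)
    (hD : Bornology.IsBounded (D : Set (EuclideanSpace ℝ (Fin n)))) (hw : IsWeight w)
    (hwc : ContinuousOn w (D : Set (EuclideanSpace ℝ (Fin n))))
    (hwn : ∫⁻ x in (D : Set (EuclideanSpace ℝ (Fin n))),
      ENNReal.ofReal (w x) ^ (-((n : ℝ) / 2)) < ∞)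
    (hf : MemLp f 2 (volume.restrict (D : Set (EuclideanSpace ℝ (Fin n))))) :
    ∃ u : EuclideanSpace ℝ (Fin n) → ℝ, MemEnergyClosure D w u ∧ IsWeakSolution D w f u := by
  have := isFiniteMeasure_weightedMeasure hD hw
  have hac := absolutelyContinuous_weightedMeasure hw (ae_pos_of_lintegral_lt_top hn hw hwn)
  have := isFiniteMeasure_restrict_of_isBounded hD
  obtain ⟨K, hK⟩ := exists_eLpNorm_two_le hn hw hwn
  obtain ⟨K₁, hK₁⟩ := exists_eLpNorm_one_le (F := EuclideanSpace ℝ (Fin n)) hn hD hw hwn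
  have hf1 : IntegrableOn f (D : Set (EuclideanSpace ℝ (Fin n))) := hf.integrable (by norm_num)
  set ν := volume.restrict (D : Set (EuclideanSpace ℝ (Fin n)))
  have hbound : ∀ φ : 𝓓(D, ℝ), ‖sourceFunctional hf1.locallyIntegrableOn φ‖ ≤
      (eLpNorm f 2 ν).toReal * K * ‖gradientLp (weightedMeasure D w) φ‖ := fun φ => by
    have h1 : eLpNorm (f • ⇑φ) 1 ν ≤
        eLpNorm f 2 ν * (K * eLpNorm (∇ (⇑φ)) 2 (weightedMeasure D w)) :=
      (eLpNorm_smul_le_mul_eLpNorm (p := 2) (q := 2) (memLp_testFunction ν φ).1 hf.1).trans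
        (by gcongr; exact hK φ)
    have hfin : eLpNorm f 2 ν * (K * eLpNorm (∇ (⇑φ)) 2 (weightedMeasure D w)) ≠ ∞ :=
      ENNReal.mul_ne_top hf.2.ne
        (ENNReal.mul_ne_top ENNReal.coe_ne_top (memLp_gradient _ φ).2.ne)
    change ‖-∫ x in (D : Set (EuclideanSpace ℝ (Fin n))), f x * φ x‖ ≤ _
    rw [norm_neg, norm_gradientLp, mul_assoc]
    have h2 : ‖∫ x in (D : Set (EuclideanSpace ℝ (Fin n))), f x * φ x‖ₑ ≤
        eLpNorm f 2 ν * (K * eLpNorm (∇ (⇑φ)) 2 (weightedMeasure D w)) := by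
      refine (enorm_integral_le_lintegral_enorm _).trans (le_trans (le_of_eq ?_) h1)
      rw [eLpNorm_one_eq_lintegral_enorm]
      rfl
    have h3 := ENNReal.toReal_mono hfin h2
    simpa using h3
  obtain ⟨g, hg, ⟨φ, hφ⟩, hgη⟩ := exists_riesz_gradient _ _ hbound
  obtain ⟨u, hu, hφu⟩ := exists_tendsto_of_tendsto_gradient hK hg hφ
  have mg : AEStronglyMeasurable g ν := hg.1.mono_ac hac
  have hg1 : IntegrableOn g (D : Set (EuclideanSpace ℝ (Fin n))) := by
    refine memLp_one_iff_integrable.1 ⟨mg, (hK₁ g mg).trans_lt ?_⟩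
    exact ENNReal.mul_lt_top ENNReal.coe_lt_top hg.2
  have hu1 : IntegrableOn u (D : Set (EuclideanSpace ℝ (Fin n))) := hu.integrable (by norm_num)
  have t1 : Tendsto (fun k => eLpNorm (fun x => φ k x - u x) 1 ν) atTop (𝓝 0) := by
    obtain ⟨K₂, hK₂⟩ := exists_eLpNorm_one_le_of_isFiniteMeasure (F := ℝ) ν (p := 2) (by norm_num)
    exact tendsto_zero_of_le_mul (fun k => hK₂ _ ((memLp_testFunction ν (φ k)).1.sub hu.1)) hφu
  have t2 : Tendsto (fun k => eLpNorm (fun x => ∇ (⇑(φ k)) x - g x) 1 ν) atTop (𝓝 0) :=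
    tendsto_zero_of_le_mul (fun k => hK₁ _ ((memLp_gradient ν (φ k)).1.sub mg)) hφ
  have hug := hasWeakGradient_of_tendsto hu1 hg1 t1 t2
  refine ⟨u, ⟨g, hug, hg, φ, hφ, fun K hK hKD => ?_⟩, g, hug, ?_, fun η => ?_⟩
  · exact tendsto_of_tendsto_of_tendsto_of_le_of_le tendsto_const_nhds t1 (fun _ => zero_le)
      fun k => eLpNorm_mono_measure _ (Measure.restrict_mono hKD le_rfl)
  · exact hg1.locallyIntegrableOn.continuousOn_smul D.isOpen.isLocallyClosed hwc
  · rw [setIntegral_mul_eq_integral_weightedMeasure hw, hgη η]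
    rfl

/-- Uniqueness in the energy space: the gradient of the difference of two solutions is orthogonal
to all gradients and a limit of gradients. -/
lemma ae_eq_of_memEnergyClosure (hn : 2 ≤ n)
    (hD : Bornology.IsBounded (D : Set (EuclideanSpace ℝ (Fin n)))) (hw : IsWeight w)
    (hwn : ∫⁻ x in (D : Set (EuclideanSpace ℝ (Fin n))),
      ENNReal.ofReal (w x) ^ (-((n : ℝ) / 2)) < ∞)
    {u v : EuclideanSpace ℝ (Fin n) → ℝ}
    (hu : MemEnergyClosure D w u) (hu' : IsWeakSolution D w f u)
    (hv : MemEnergyClosure D w v) (hv' : IsWeakSolution D w f v) :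
    u =ᵐ[volume.restrict (D : Set (EuclideanSpace ℝ (Fin n)))] v := by
  have := isFiniteMeasure_weightedMeasure hD hw
  obtain ⟨g, hug, hg, φ, hφ, hφu⟩ := hu
  obtain ⟨h, hvh, hh, ψ, hψ, hψv⟩ := hv
  obtain ⟨g', hug', -, hg'⟩ := hu'
  obtain ⟨h', hvh', -, hh'⟩ := hv'
  set μ := weightedMeasure D w
  have hgh : MemLp (fun x => g x - h x) 2 μ := hg.sub hh
  have hlim : Tendsto (fun k => eLpNorm (fun x => ∇ (⇑(φ k - ψ k)) x - (g x - h x)) 2 μ)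
      atTop (𝓝 0) := by
    have e : (hgh.toLp _ : Lp (EuclideanSpace ℝ (Fin n)) 2 μ) = hg.toLp g - hh.toLp h :=
      MemLp.toLp_sub hg hh
    refine (tendsto_gradientLp_iff μ hgh fun k => φ k - ψ k).1 ?_
    rw [e]
    simp_rw [map_sub]
    exact ((tendsto_gradientLp_iff μ hg φ).2 hφ).sub ((tendsto_gradientLp_iff μ hh ψ).2 hψ)
  have horth : ∀ η : 𝓓(D, ℝ), ∫ x, inner ℝ (g x - h x) (∇ (⇑η) x) ∂μ = 0 := fun η => by
    have ig : Integrable (fun x => inner ℝ (g x) (∇ (⇑η) x)) μ :=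
      integrable_inner_gradient hg η
    have ih : Integrable (fun x => inner ℝ (h x) (∇ (⇑η) x)) μ :=
      integrable_inner_gradient hh η
    simp_rw [inner_sub_left]
    rw [integral_sub ig ih, ← setIntegral_mul_eq_integral_weightedMeasure hw,
      ← setIntegral_mul_eq_integral_weightedMeasure hw, sub_eq_zero]
    refine (Eq.trans ?_ (hg' η)).trans ((hh' η).symm.trans ?_)
    · refine integral_congr_ae ?_
      filter_upwards [hug.ae_eq hug'] with x hx
      rw [hx]
    · refine integral_congr_ae ?_
      filter_upwards [hvh.ae_eq hvh'] with x hx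
      rw [hx]
  have hzero := ae_eq_zero_of_forall_integral_inner_eq_zero hgh hlim horth
  have hgrad : Tendsto (fun k => eLpNorm (∇ (⇑(φ k - ψ k))) 2 μ) atTop (𝓝 0) := by
    refine hlim.congr fun k => eLpNorm_congr_ae ?_
    filter_upwards [hzero] with x hx
    rw [hx, Pi.zero_apply, sub_zero]
  obtain ⟨K, hK⟩ := exists_eLpNorm_one_le_gradient hn hD hw hwn
  refine ae_eq_of_tendsto_eLpNorm_one hug.1 hvh.1 hφu hψv ?_
  exact tendsto_zero_of_le_mul (fun k => hK (φ k - ψ k)) hgrad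

end Energy

/-! ### Comparison of the two closures -/

/-- The weighted Sobolev norm dominates the energy norm and, by `exists_eLpNorm_one_le`, the
`L_1(D)`-norm. -/
lemma MemSobolevZero.memEnergyClosure (hn : 2 ≤ n)
    (hD : Bornology.IsBounded (D : Set (EuclideanSpace ℝ (Fin n)))) (hw : IsWeight w)
    (hwn : ∫⁻ x in (D : Set (EuclideanSpace ℝ (Fin n))),
      ENNReal.ofReal (w x) ^ (-((n : ℝ) / 2)) < ∞)
    {u : EuclideanSpace ℝ (Fin n) → ℝ} (hu : MemSobolevZero D w u) : MemEnergyClosure D w u := by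
  obtain ⟨g, hug, hu2, hg, φ, hφ⟩ := hu
  have hac := absolutelyContinuous_weightedMeasure hw (ae_pos_of_lintegral_lt_top hn hw hwn)
  obtain ⟨K₁, hK₁⟩ := exists_eLpNorm_one_le (F := ℝ) hn hD hw hwn
  refine ⟨g, hug, hg, φ, ?_, fun K hK hKD => ?_⟩
  · exact tendsto_of_tendsto_of_tendsto_of_le_of_le tendsto_const_nhds hφ (fun _ => zero_le)
      fun k => le_add_self
  · refine tendsto_zero_of_le_mul (K := K₁) (fun k => ?_) hφ
    calc eLpNorm (fun x => φ k x - u x) 1 (volume.restrict K)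
        ≤ eLpNorm (fun x => φ k x - u x) 1
          (volume.restrict (D : Set (EuclideanSpace ℝ (Fin n)))) :=
          eLpNorm_mono_measure _ (Measure.restrict_mono hKD le_rfl)
      _ ≤ K₁ * eLpNorm (fun x => φ k x - u x) 2 (weightedMeasure D w) :=
          hK₁ _ ((φ k).continuous.aestronglyMeasurable.sub (hu2.1.mono_ac hac))
      _ ≤ _ := by gcongr; exact le_self_add

/-- Under a weighted Poincaré inequality the energy closure lies in the weighted Sobolev space. -/
lemma MemEnergyClosure.memSobolevZero (hn : 2 ≤ n)
    (hD : Bornology.IsBounded (D : Set (EuclideanSpace ℝ (Fin n)))) (hw : IsWeight w)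
    (hwn : ∫⁻ x in (D : Set (EuclideanSpace ℝ (Fin n))),
      ENNReal.ofReal (w x) ^ (-((n : ℝ) / 2)) < ∞)
    {K : ℝ≥0} (hK : ∀ φ : 𝓓(D, ℝ), eLpNorm φ 2 (weightedMeasure D w) ≤
      K * eLpNorm (∇ (⇑φ)) 2 (weightedMeasure D w))
    {u : EuclideanSpace ℝ (Fin n) → ℝ} (hu : MemEnergyClosure D w u) : MemSobolevZero D w u := by
  have := isFiniteMeasure_weightedMeasure hD hw
  have hac := absolutelyContinuous_weightedMeasure hw (ae_pos_of_lintegral_lt_top hn hw hwn)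
  obtain ⟨g, hug, hg, φ, hφ, hφu⟩ := hu
  obtain ⟨v, hv, hφv⟩ := exists_tendsto_of_tendsto_gradient hK hg hφ
  obtain ⟨K₁, hK₁⟩ := exists_eLpNorm_one_le (F := ℝ) hn hD hw hwn
  have mv := hv.1.mono_ac hac
  have hv1 : IntegrableOn v (D : Set (EuclideanSpace ℝ (Fin n))) :=
    memLp_one_iff_integrable.1 ⟨mv, (hK₁ v mv).trans_lt
      (ENNReal.mul_lt_top ENNReal.coe_lt_top hv.2)⟩
  have huv : u =ᵐ[volume.restrict (D : Set (EuclideanSpace ℝ (Fin n)))] v := by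
    refine ae_eq_of_tendsto_eLpNorm_one (ψ := φ) hug.1 hv1.locallyIntegrableOn hφu
      (fun K hK hKD => ?_) ?_
    · refine tendsto_zero_of_le_mul (K := K₁) (fun k => ?_) hφv
      exact (eLpNorm_mono_measure _ (Measure.restrict_mono hKD le_rfl)).trans
        (hK₁ _ ((φ k).continuous.aestronglyMeasurable.sub mv))
    · have : ∀ k, ⇑(φ k - φ k) = 0 := fun k => by rw [sub_self]; rfl
      simp_rw [this, eLpNorm_zero]
      exact tendsto_const_nhds
  have huv' : u =ᵐ[weightedMeasure D w] v := weightedMeasure_absolutelyContinuous huv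
  refine ⟨g, hug, (memLp_congr_ae huv').2 hv, hg, φ, ?_⟩
  have e : ∀ k, sobolevNorm D w (fun x => φ k x - u x) (fun x => ∇ (⇑(φ k)) x - g x) =
      eLpNorm (fun x => φ k x - v x) 2 (weightedMeasure D w) +
        eLpNorm (fun x => ∇ (⇑(φ k)) x - g x) 2 (weightedMeasure D w) := fun k => by
    rw [sobolevNorm]
    congr 1
    refine eLpNorm_congr_ae ?_
    filter_upwards [huv'] with x hx
    rw [hx]
  simp_rw [e]
  simpa using hφv.add hφ

/-! ### Averages over balls and the Muckenhoupt condition -/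

lemma sq_rpow_half_mul (a b : ℝ≥0∞) :
    (a ^ (1 / 2 : ℝ) * b ^ (1 / 2 : ℝ)) ^ 2 = a * b := by
  rw [mul_pow, ← ENNReal.rpow_natCast, ← ENNReal.rpow_natCast, ← ENNReal.rpow_mul,
    ← ENNReal.rpow_mul]
  norm_num

/-- The Cauchy-Schwarz inequality with a weight. -/
lemma sq_lintegral_le_mul {α : Type*} [MeasurableSpace α] {ν : Measure α} {F W : α → ℝ≥0∞}
    (hF : Measurable F) (hW : Measurable W) (h0 : ∀ᵐ x ∂ν, W x ≠ 0) (ht : ∀ᵐ x ∂ν, W x ≠ ∞) :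
    (∫⁻ x, F x ∂ν) ^ 2 ≤ (∫⁻ x, F x ^ 2 * W x ∂ν) * ∫⁻ x, (W x)⁻¹ ∂ν := by
  have e1 : ∫⁻ x, F x ∂ν =
      ∫⁻ x, ((fun x => F x * W x ^ (1 / 2 : ℝ)) * fun x => W x ^ (-(1 / 2) : ℝ)) x ∂ν := by
    refine lintegral_congr_ae ?_
    filter_upwards [h0, ht] with x hx0 hxt
    rw [Pi.mul_apply, mul_assoc, ← ENNReal.rpow_add _ _ hx0 hxt]
    simp
  have e2 : ∀ x, (F x * W x ^ (1 / 2 : ℝ)) ^ (2 : ℝ) = F x ^ 2 * W x := fun x => by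
    rw [ENNReal.mul_rpow_of_nonneg _ _ (by norm_num), ← ENNReal.rpow_mul]
    norm_num
  have e3 : ∀ x, (W x ^ (-(1 / 2) : ℝ)) ^ (2 : ℝ) = (W x)⁻¹ := fun x => by
    rw [← ENNReal.rpow_mul]
    norm_num [ENNReal.rpow_neg_one]
  have h := ENNReal.lintegral_mul_le_Lp_mul_Lq ν Real.HolderConjugate.two_two
    (f := fun x => F x * W x ^ (1 / 2 : ℝ))
    (hF.mul (hW.pow_const (1 / 2 : ℝ))).aemeasurable (hW.pow_const (-(1 / 2) : ℝ)).aemeasurable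
  rw [← e1] at h
  simp_rw [e2, e3] at h
  calc (∫⁻ x, F x ∂ν) ^ 2 ≤ _ ^ 2 := by gcongr
    _ = _ := sq_rpow_half_mul _ _

lemma measurable_lintegral_ball {h : EuclideanSpace ℝ (Fin n) → ℝ≥0∞} (hh : Measurable h)
    (ρ : ℝ) : Measurable fun x => ∫⁻ y in Metric.ball x ρ, h y := by
  have e : (fun x => ∫⁻ y in Metric.ball x ρ, h y) = fun x => ∫⁻ y,
      {q : EuclideanSpace ℝ (Fin n) × EuclideanSpace ℝ (Fin n) | dist q.2 q.1 < ρ}.indicator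
        (fun q => h q.2) (x, y) := by
    funext x
    rw [← lintegral_indicator measurableSet_ball]
    rfl
  rw [e]
  refine Measurable.lintegral_prod_right' ((hh.comp measurable_snd).indicator ?_)
  exact measurableSet_lt (by fun_prop) measurable_const

/-- Under the `A_2`-condition the averages over balls of radius `ρ` are bounded on the weighted
`L_2`, uniformly in `ρ`. By the Cauchy-Schwarz inequality and Tonelli's theorem only
`∫_{B(y,ρ)} W(x) ∫_{B(x,ρ)} W⁻¹ dx` has to be estimated, and `B(x, ρ) ⊆ B(y, 2ρ)` there. -/
lemma lintegral_sq_lintegral_ball_le {W F : EuclideanSpace ℝ (Fin n) → ℝ≥0∞}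
    (hW : Measurable W) (hF : Measurable F) (h0 : ∀ᵐ x, W x ≠ 0) (ht : ∀ᵐ x, W x ≠ ∞)
    {C : ℝ≥0} (hC : ∀ x r, 0 < r → (∫⁻ y in Metric.ball x r, W y) *
      (∫⁻ y in Metric.ball x r, (W y)⁻¹) ≤ C * volume (Metric.ball x r) ^ 2)
    {ρ : ℝ} (hρ : 0 < ρ) :
    ∫⁻ x, (∫⁻ y in Metric.ball x ρ, F y) ^ 2 * W x ≤
      C * volume (Metric.ball (0 : EuclideanSpace ℝ (Fin n)) (2 * ρ)) ^ 2 *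
        ∫⁻ y, F y ^ 2 * W y := by
  set S : EuclideanSpace ℝ (Fin n) → ℝ≥0∞ := fun x => ∫⁻ y in Metric.ball x ρ, (W y)⁻¹
  have hS : Measurable S := measurable_lintegral_ball hW.inv ρ
  set A : Set (EuclideanSpace ℝ (Fin n) × EuclideanSpace ℝ (Fin n)) := {q | dist q.2 q.1 < ρ}
  have hA : MeasurableSet A := measurableSet_lt (by fun_prop) measurable_const
  set k : EuclideanSpace ℝ (Fin n) → EuclideanSpace ℝ (Fin n) → ℝ≥0∞ := fun x y =>
    A.indicator (fun q => F q.2 ^ 2 * W q.2 * (S q.1 * W q.1)) (x, y)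
  have hk : Measurable (Function.uncurry k) := by
    refine Measurable.indicator ?_ hA
    fun_prop
  calc ∫⁻ x, (∫⁻ y in Metric.ball x ρ, F y) ^ 2 * W x
      ≤ ∫⁻ x, ∫⁻ y, k x y := by
        refine lintegral_mono fun x => ?_
        have e : ∫⁻ y, k x y = (∫⁻ y in Metric.ball x ρ, F y ^ 2 * W y) * (S x * W x) := by
          rw [← lintegral_mul_const _ (by fun_prop), ← lintegral_indicator measurableSet_ball]
          rfl
        rw [e, ← mul_assoc]
        gcongr
        exact sq_lintegral_le_mul hF hW (ae_restrict_of_ae h0) (ae_restrict_of_ae ht)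
    _ = ∫⁻ y, ∫⁻ x, k x y := lintegral_lintegral_swap hk.aemeasurable
    _ ≤ ∫⁻ y, C * volume (Metric.ball (0 : EuclideanSpace ℝ (Fin n)) (2 * ρ)) ^ 2 *
        (F y ^ 2 * W y) := by
        refine lintegral_mono fun y => ?_
        have e : ∫⁻ x, k x y = F y ^ 2 * W y * ∫⁻ x in Metric.ball y ρ, S x * W x := by
          rw [← lintegral_const_mul _ (by fun_prop), ← lintegral_indicator measurableSet_ball]
          refine lintegral_congr fun x => ?_
          by_cases hx : dist y x < ρ
          · have h1 : (x, y) ∈ A := hx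
            have h2 : x ∈ Metric.ball y ρ := by rwa [Metric.mem_ball, dist_comm]
            simp only [k, Set.indicator_of_mem h1, Set.indicator_of_mem h2]
          · have h1 : (x, y) ∉ A := hx
            have h2 : x ∉ Metric.ball y ρ := by rwa [Metric.mem_ball, dist_comm]
            simp only [k, Set.indicator_of_notMem h1, Set.indicator_of_notMem h2]
        rw [e, mul_comm (F y ^ 2 * W y)]
        gcongr
        calc ∫⁻ x in Metric.ball y ρ, S x * W x
            ≤ ∫⁻ x in Metric.ball y ρ, (∫⁻ z in Metric.ball y (2 * ρ), (W z)⁻¹) * W x := by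
              refine setLIntegral_mono (by fun_prop) fun x hx => ?_
              gcongr
              refine lintegral_mono_set (Metric.ball_subset_ball' ?_)
              rw [Metric.mem_ball] at hx
              linarith
          _ = (∫⁻ z in Metric.ball y (2 * ρ), (W z)⁻¹) * ∫⁻ x in Metric.ball y ρ, W x :=
              lintegral_const_mul _ hW
          _ ≤ (∫⁻ z in Metric.ball y (2 * ρ), (W z)⁻¹) * ∫⁻ x in Metric.ball y (2 * ρ), W x := by
              gcongr
              linarith
          _ ≤ C * volume (Metric.ball y (2 * ρ)) ^ 2 := by
              rw [mul_comm]
              exact hC y _ (by linarith)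
          _ = _ := by rw [Measure.addHaar_ball_center]
    _ = _ := lintegral_const_mul _ (by fun_prop)

lemma setLIntegral_ball_comp_add_smul {F : EuclideanSpace ℝ (Fin n) → ℝ≥0∞} (hF : Measurable F)
    (x : EuclideanSpace ℝ (Fin n)) {t : ℝ} (ht : 0 < t) (s : ℝ) :
    ∫⁻ z in Metric.ball 0 s, F (x + t • z) =
      ENNReal.ofReal (t ^ n)⁻¹ * ∫⁻ y in Metric.ball x (t * s), F y := by
  set H : EuclideanSpace ℝ (Fin n) → ℝ≥0∞ := (Metric.ball x (t * s)).indicator F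
  have hH : Measurable H := hF.indicator measurableSet_ball
  have e1 : ∫⁻ z in Metric.ball 0 s, F (x + t • z) = ∫⁻ z, H (x + t • z) := by
    rw [← lintegral_indicator measurableSet_ball]
    refine lintegral_congr fun z => ?_
    have : z ∈ Metric.ball 0 s ↔ x + t • z ∈ Metric.ball x (t * s) := by
      rw [mem_ball_zero_iff, Metric.mem_ball, dist_eq_norm, add_sub_cancel_left, norm_smul,
        Real.norm_of_nonneg ht.le, mul_lt_mul_iff_right₀ ht]
    by_cases hz : z ∈ Metric.ball 0 s
    · simp only [H, Set.indicator_of_mem hz, Set.indicator_of_mem (this.1 hz)]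
    · simp only [H, Set.indicator_of_notMem hz, Set.indicator_of_notMem (mt this.2 hz)]
  have e2 : ∫⁻ z, H (x + t • z) = ∫⁻ y, H (x + y) ∂(Measure.map (t • ·) volume) :=
    (lintegral_map (f := fun y => H (x + y)) (by fun_prop) (by fun_prop)).symm
  rw [e1, e2, Measure.map_addHaar_smul _ ht.ne', lintegral_smul_measure,
    lintegral_add_left_eq_self, lintegral_indicator measurableSet_ball, finrank_euclideanSpace_fin,
    abs_of_pos (by positivity)]
  rfl

/-! ### The weighted Poincaré inequality -/

/-- Integration of the gradient along segments leaving `D`: all `z ∈ B(e, 1)` with `|e| = 2` satisfy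
`1 < |z| < 3`, so that `x + 2Rz` lies outside the ball of radius `R` around `0` if `|x| < R`. -/
lemma enorm_mul_volume_le (φ : 𝓓(D, ℝ)) {R : ℝ} (hR : 0 < R)
    (hD : (D : Set (EuclideanSpace ℝ (Fin n))) ⊆ Metric.ball 0 R)
    {e : EuclideanSpace ℝ (Fin n)} (he : ‖e‖ = 2) (x : EuclideanSpace ℝ (Fin n)) :
    ‖φ x‖ₑ * volume (Metric.ball e 1) ≤
      3 * ∫⁻ t in Set.Ioc 0 (2 * R), ∫⁻ z in Metric.ball 0 3, ‖∇ (⇑φ) (x + t • z)‖ₑ := by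
  by_cases hx : x ∈ D
  swap
  · simp [testFunction_eq_zero φ hx]
  have hxR : ‖x‖ < R := by simpa using hD hx
  have hnorm : ∀ z ∈ Metric.ball e 1, 1 < ‖z‖ ∧ ‖z‖ < 3 := fun z hz => by
    rw [Metric.mem_ball, dist_eq_norm] at hz
    have h1 := norm_sub_norm_le z e
    have h2 := norm_sub_norm_le e z
    rw [norm_sub_rev] at h2
    constructor <;> linarith
  have hray : ∀ z ∈ Metric.ball e 1,
      ‖φ x‖ₑ ≤ ∫⁻ t in Set.Ioc 0 (2 * R), 3 * ‖∇ (⇑φ) (x + t • z)‖ₑ := fun z hz => by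
    obtain ⟨hz1, hz3⟩ := hnorm z hz
    have hout : x + (2 * R) • z ∉ D := fun h => by
      have h1 : ‖x + (2 * R) • z‖ < R := by simpa using hD h
      have h2 : ‖(2 * R) • z‖ ≤ ‖x + (2 * R) • z‖ + ‖x‖ := by
        simpa using norm_sub_le (x + (2 * R) • z) x
      rw [norm_smul, Real.norm_of_nonneg (by positivity)] at h2
      nlinarith
    have hd : ∀ t ∈ Set.uIcc 0 (2 * R), HasDerivAt (fun t : ℝ => φ (x + t • z))
        (fderiv ℝ φ (x + t • z) z) t := fun t _ => by
      have h1 : HasDerivAt (fun t : ℝ => x + t • z) z t := by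
        simpa using ((hasDerivAt_id t).smul_const z).const_add x
      exact (differentiable_testFunction φ _).hasFDerivAt.comp_hasDerivAt t h1
    have hc : Continuous fun t : ℝ => fderiv ℝ φ (x + t • z) z :=
      ((φ.contDiff.continuous_fderiv (by simp)).comp (by fun_prop)).clm_apply continuous_const
    have hftc := intervalIntegral.integral_eq_sub_of_hasDerivAt hd (hc.intervalIntegrable _ _)
    rw [testFunction_eq_zero φ hout, zero_smul, add_zero, zero_sub,
      intervalIntegral.integral_of_le (by positivity)] at hftc
    rw [← enorm_neg, ← hftc]
    refine (enorm_integral_le_lintegral_enorm _).trans (lintegral_mono fun t => ?_)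
    have h1 : ‖fderiv ℝ φ (x + t • z) z‖ ≤ 3 * ‖∇ (⇑φ) (x + t • z)‖ := by
      rw [norm_gradient, mul_comm]
      exact (ContinuousLinearMap.le_opNorm _ _).trans (by gcongr)
    have h2 := ENNReal.ofReal_le_ofReal h1
    rw [ENNReal.ofReal_mul (by norm_num), ofReal_norm, ofReal_norm] at h2
    simpa using h2
  have hm : Measurable fun q : EuclideanSpace ℝ (Fin n) × ℝ =>
      3 * ‖∇ (⇑φ) (x + q.2 • q.1)‖ₑ :=
    (((continuous_gradient φ).comp (by fun_prop)).enorm.measurable).const_mul 3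
  have hsub : Metric.ball e 1 ⊆ Metric.ball 0 3 := fun z hz => by simpa using (hnorm z hz).2
  have hm' : Measurable fun t : ℝ => ∫⁻ z in Metric.ball 0 3, ‖∇ (⇑φ) (x + t • z)‖ₑ :=
    Measurable.lintegral_prod_right'
      (f := fun q : ℝ × EuclideanSpace ℝ (Fin n) => ‖∇ (⇑φ) (x + q.1 • q.2)‖ₑ)
      (((continuous_gradient φ).comp (by fun_prop)).enorm.measurable)
  have hm'' : ∀ t : ℝ, Measurable fun z => ‖∇ (⇑φ) (x + t • z)‖ₑ := fun t =>
    ((continuous_gradient φ).comp (by fun_prop)).enorm.measurable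
  calc ‖φ x‖ₑ * volume (Metric.ball e 1) = ∫⁻ _ in Metric.ball e 1, ‖φ x‖ₑ := by
        rw [setLIntegral_const]
    _ ≤ ∫⁻ z in Metric.ball e 1, ∫⁻ t in Set.Ioc 0 (2 * R), 3 * ‖∇ (⇑φ) (x + t • z)‖ₑ :=
        setLIntegral_mono (Measurable.lintegral_prod_right' hm) hray
    _ ≤ ∫⁻ z in Metric.ball 0 3, ∫⁻ t in Set.Ioc 0 (2 * R), 3 * ‖∇ (⇑φ) (x + t • z)‖ₑ :=
        lintegral_mono_set hsub
    _ = ∫⁻ t in Set.Ioc 0 (2 * R), ∫⁻ z in Metric.ball 0 3, 3 * ‖∇ (⇑φ) (x + t • z)‖ₑ :=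
        lintegral_lintegral_swap hm.aemeasurable
    _ = _ := by
        rw [← lintegral_const_mul 3 hm']
        exact lintegral_congr fun t => lintegral_const_mul 3 (hm'' t)

/-- The weighted Poincaré inequality of Fabes, Kenig and Serapioni for an `A_2`-weight, with the
weight as a function with values in `[0, ∞]`. -/
lemma lintegral_sq_mul_le {W : EuclideanSpace ℝ (Fin n) → ℝ≥0∞}
    (hW : Measurable W) (h0 : ∀ᵐ x, W x ≠ 0) (ht : ∀ᵐ x, W x ≠ ∞)
    {C : ℝ≥0} (hC : ∀ x r, 0 < r → (∫⁻ y in Metric.ball x r, W y) *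
      (∫⁻ y in Metric.ball x r, (W y)⁻¹) ≤ C * volume (Metric.ball x r) ^ 2)
    {R : ℝ} (hR : 0 < R) (hD : (D : Set (EuclideanSpace ℝ (Fin n))) ⊆ Metric.ball 0 R)
    {e : EuclideanSpace ℝ (Fin n)} (he : ‖e‖ = 2) (φ : 𝓓(D, ℝ)) :
    (∫⁻ x, ‖φ x‖ₑ ^ 2 * W x) * volume (Metric.ball e 1) ^ 2 ≤
      9 * ENNReal.ofReal (2 * R) ^ 2 *
        (C * volume (Metric.ball (0 : EuclideanSpace ℝ (Fin n)) 6) ^ 2) *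
        ∫⁻ x, ‖∇ (⇑φ) x‖ₑ ^ 2 * W x := by
  set I := Set.Ioc 0 (2 * R)
  set F : EuclideanSpace ℝ (Fin n) → ℝ≥0∞ := fun x => ‖∇ (⇑φ) x‖ₑ
  have hF : Measurable F := (continuous_gradient φ).enorm.measurable
  set G : EuclideanSpace ℝ (Fin n) × ℝ → ℝ≥0∞ := fun q =>
    ∫⁻ z in Metric.ball 0 3, F (q.1 + q.2 • z)
  have hG : Measurable G := Measurable.lintegral_prod_right'
    (f := fun q : (EuclideanSpace ℝ (Fin n) × ℝ) × EuclideanSpace ℝ (Fin n) =>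
      F (q.1.1 + q.1.2 • q.2))
    (((continuous_gradient φ).comp (by fun_prop)).enorm.measurable)
  have hGx : ∀ x, Measurable fun t => G (x, t) := fun x => hG.comp (by fun_prop)
  have hmφ : Measurable fun x => ‖φ x‖ₑ ^ 2 * W x :=
    (φ.continuous.enorm.measurable.pow_const 2).mul hW
  have hvol : volume I = ENNReal.ofReal (2 * R) := by simp [I]
  have havg : ∀ t ∈ I, ∫⁻ x, G (x, t) ^ 2 * W x ≤
      C * volume (Metric.ball (0 : EuclideanSpace ℝ (Fin n)) 6) ^ 2 * ∫⁻ x, F x ^ 2 * W x := by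
    intro t htI
    have ht0 : 0 < t := htI.1
    have e1 : ∀ x, G (x, t) ^ 2 * W x = ENNReal.ofReal (t ^ n)⁻¹ ^ 2 *
        ((∫⁻ y in Metric.ball x (t * 3), F y) ^ 2 * W x) := fun x => by
      simp only [G]
      rw [setLIntegral_ball_comp_add_smul hF x ht0, mul_pow, mul_assoc]
    have e2 : ENNReal.ofReal (t ^ n)⁻¹ *
        volume (Metric.ball (0 : EuclideanSpace ℝ (Fin n)) (2 * (t * 3))) =
        volume (Metric.ball (0 : EuclideanSpace ℝ (Fin n)) 6) := by
      rw [show 2 * (t * 3) = t * 6 by ring, Measure.addHaar_ball_mul_of_pos _ _ ht0, ← mul_assoc,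
        finrank_euclideanSpace_fin, ← ENNReal.ofReal_mul (by positivity),
        inv_mul_cancel₀ (by positivity), ENNReal.ofReal_one, one_mul]
    simp_rw [e1]
    have hm : Measurable fun x => (∫⁻ y in Metric.ball x (t * 3), F y) ^ 2 * W x :=
      ((measurable_lintegral_ball hF _).pow_const 2).mul hW
    rw [lintegral_const_mul _ hm]
    calc _ ≤ ENNReal.ofReal (t ^ n)⁻¹ ^ 2 * (C *
          volume (Metric.ball (0 : EuclideanSpace ℝ (Fin n)) (2 * (t * 3))) ^ 2 *
            ∫⁻ y, F y ^ 2 * W y) := by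
          gcongr
          exact lintegral_sq_lintegral_ball_le hW hF h0 ht hC (by positivity)
      _ = C * (ENNReal.ofReal (t ^ n)⁻¹ *
          volume (Metric.ball (0 : EuclideanSpace ℝ (Fin n)) (2 * (t * 3)))) ^ 2 *
            ∫⁻ y, F y ^ 2 * W y := by ring
      _ = _ := by rw [e2]
  calc (∫⁻ x, ‖φ x‖ₑ ^ 2 * W x) * volume (Metric.ball e 1) ^ 2
      = ∫⁻ x, ‖φ x‖ₑ ^ 2 * W x * volume (Metric.ball e 1) ^ 2 :=
        (lintegral_mul_const _ hmφ).symm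
    _ ≤ ∫⁻ x, 9 * ENNReal.ofReal (2 * R) * ∫⁻ t in I, G (x, t) ^ 2 * W x := by
        refine lintegral_mono fun x => ?_
        have h1 := sq_lintegral_le_mul (ν := volume.restrict I) (hGx x) (W := fun _ => 1)
          measurable_const (by simp) (by simp)
        simp only [mul_one, inv_one, lintegral_one, Measure.restrict_apply_univ, hvol] at h1
        calc ‖φ x‖ₑ ^ 2 * W x * volume (Metric.ball e 1) ^ 2
            = (‖φ x‖ₑ * volume (Metric.ball e 1)) ^ 2 * W x := by ring
          _ ≤ (3 * ∫⁻ t in I, G (x, t)) ^ 2 * W x := by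
              gcongr ?_ ^ 2 * _
              exact enorm_mul_volume_le φ hR hD he x
          _ = 9 * (∫⁻ t in I, G (x, t)) ^ 2 * W x := by ring
          _ ≤ 9 * ((∫⁻ t in I, G (x, t) ^ 2) * ENNReal.ofReal (2 * R)) * W x := by gcongr
          _ = 9 * ENNReal.ofReal (2 * R) * ((∫⁻ t in I, G (x, t) ^ 2) * W x) := by ring
          _ = _ := by rw [lintegral_mul_const _ ((hGx x).pow_const 2)]
    _ = 9 * ENNReal.ofReal (2 * R) * ∫⁻ x, ∫⁻ t in I, G (x, t) ^ 2 * W x :=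
        lintegral_const_mul _ (Measurable.lintegral_prod_right'
          (f := fun q : EuclideanSpace ℝ (Fin n) × ℝ => G q ^ 2 * W q.1) (by fun_prop))
    _ = 9 * ENNReal.ofReal (2 * R) * ∫⁻ t in I, ∫⁻ x, G (x, t) ^ 2 * W x := by
        congr 1
        exact lintegral_lintegral_swap (Measurable.aemeasurable
          (f := fun q : EuclideanSpace ℝ (Fin n) × ℝ => G q ^ 2 * W q.1) (by fun_prop))
    _ ≤ 9 * ENNReal.ofReal (2 * R) * ∫⁻ _ in I,
        C * volume (Metric.ball (0 : EuclideanSpace ℝ (Fin n)) 6) ^ 2 * ∫⁻ x, F x ^ 2 * W x := by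
        gcongr 1
        exact setLIntegral_mono measurable_const havg
    _ = _ := by
        rw [setLIntegral_const, hvol]
        ring

lemma sq_eLpNorm_two_weightedMeasure (hw : IsWeight w) {F : Type*} [NormedAddCommGroup F]
    {h : EuclideanSpace ℝ (Fin n) → F} (hh : Continuous h) (hhD : ∀ x ∉ D, h x = 0) :
    eLpNorm h 2 (weightedMeasure D w) ^ 2 = ∫⁻ x, ‖h x‖ₑ ^ 2 * ENNReal.ofReal (w x) := by
  rw [eLpNorm_eq_lintegral_rpow_enorm_toReal (by simp) (by simp), weightedMeasure,
    lintegral_withDensity_eq_lintegral_mul₀ hw.aemeasurable.restrict.ennreal_ofReal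
      (hh.enorm.measurable.pow_const _).aemeasurable, ← ENNReal.rpow_natCast, ← ENNReal.rpow_mul]
  norm_num
  rw [← setLIntegral_eq_of_support_subset (s := (D : Set (EuclideanSpace ℝ (Fin n))))
    (f := fun x => ‖h x‖ₑ ^ 2 * ENNReal.ofReal (w x))]
  · exact lintegral_congr fun x => mul_comm _ _
  · intro x hx
    by_contra hc
    exact hx (by simp [hhD x hc])

/-- The weighted Poincaré inequality for test functions and an `A_2`-weight. -/
lemma exists_poincare (hn : 2 ≤ n)
    (hD : Bornology.IsBounded (D : Set (EuclideanSpace ℝ (Fin n)))) (hw : IsWeight w)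
    (hA : IsMuckenhoupt 2 w) :
    ∃ K : ℝ≥0, ∀ φ : 𝓓(D, ℝ), eLpNorm φ 2 (weightedMeasure D w) ≤
      K * eLpNorm (∇ (⇑φ)) 2 (weightedMeasure D w) := by
  obtain ⟨hpos, C, hC⟩ := hA
  obtain ⟨w', hw', hww'⟩ := hw.aemeasurable
  set W : EuclideanSpace ℝ (Fin n) → ℝ≥0∞ := fun x => ENNReal.ofReal (w' x)
  have hW : Measurable W := hw'.ennreal_ofReal
  have hWw : (fun x => ENNReal.ofReal (w x)) =ᵐ[volume] W := by
    filter_upwards [hww'] with x hx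
    rw [hx]
  have h0 : ∀ᵐ x, W x ≠ 0 := by
    filter_upwards [hpos, hWw] with x hx hx'
    rw [← hx']
    simpa using hx
  have hC' : ∀ x r, 0 < r → (∫⁻ y in Metric.ball x r, W y) *
      (∫⁻ y in Metric.ball x r, (W y)⁻¹) ≤ C * volume (Metric.ball x r) ^ 2 := fun x r hr => by
    have h := hC x r hr
    have e1 : ∫⁻ y in Metric.ball x r, ENNReal.ofReal (w y) = ∫⁻ y in Metric.ball x r, W y :=
      lintegral_congr_ae (ae_restrict_of_ae hWw)
    have e2 : ∫⁻ y in Metric.ball x r, ENNReal.ofReal (w y) ^ (1 / (1 - 2) : ℝ) =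
        ∫⁻ y in Metric.ball x r, (W y)⁻¹ := by
      refine lintegral_congr_ae (ae_restrict_of_ae ?_)
      filter_upwards [hWw] with y hy
      rw [hy]
      norm_num [ENNReal.rpow_neg_one]
    rw [e1, e2] at h
    set V := volume (Metric.ball x r)
    have hV0 : V ≠ 0 := (Metric.measure_ball_pos _ _ hr).ne'
    have hVt : V ≠ ∞ := measure_ball_lt_top.ne
    norm_num at h
    calc _ = V ^ 2 * ((V⁻¹ * ∫⁻ y in Metric.ball x r, W y) *
          (V⁻¹ * ∫⁻ y in Metric.ball x r, (W y)⁻¹)) := by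
          have := ENNReal.mul_inv_cancel hV0 hVt
          calc _ = (V * V⁻¹) * (V * V⁻¹) * ((∫⁻ y in Metric.ball x r, W y) *
                ∫⁻ y in Metric.ball x r, (W y)⁻¹) := by rw [this, one_mul, one_mul]
            _ = _ := by ring
      _ ≤ V ^ 2 * C := by gcongr
      _ = _ := mul_comm _ _
  obtain ⟨R, hR, hDR⟩ := hD.subset_ball_lt 0 0
  have : Nontrivial (EuclideanSpace ℝ (Fin n)) :=
    Module.nontrivial_of_finrank_pos (R := ℝ) (by rw [finrank_euclideanSpace_fin]; omega)
  obtain ⟨e, he⟩ := exists_norm_eq (EuclideanSpace ℝ (Fin n)) (c := 2) (by norm_num)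
  set V := volume (Metric.ball e 1)
  have hV0 : V ≠ 0 := (Metric.measure_ball_pos _ _ one_pos).ne'
  have hVt : V ≠ ∞ := measure_ball_lt_top.ne
  set M : ℝ≥0∞ := 9 * ENNReal.ofReal (2 * R) ^ 2 *
    (C * volume (Metric.ball (0 : EuclideanSpace ℝ (Fin n)) 6) ^ 2) / V ^ 2
  have hM : M ≠ ∞ := by
    refine ENNReal.div_ne_top ?_ (pow_ne_zero _ hV0)
    refine ENNReal.mul_ne_top
      (ENNReal.mul_ne_top (by simp) (ENNReal.pow_ne_top ENNReal.ofReal_ne_top)) ?_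
    exact ENNReal.mul_ne_top (by simp) (ENNReal.pow_ne_top measure_ball_lt_top.ne)
  refine ⟨(M ^ (1 / 2 : ℝ)).toNNReal, fun φ => ?_⟩
  rw [ENNReal.coe_toNNReal (ENNReal.rpow_ne_top_of_nonneg (by norm_num) hM)]
  have key : eLpNorm φ 2 (weightedMeasure D w) ^ 2 ≤
      M * eLpNorm (∇ (⇑φ)) 2 (weightedMeasure D w) ^ 2 := by
    rw [sq_eLpNorm_two_weightedMeasure hw φ.continuous fun x hx => testFunction_eq_zero φ hx,
      sq_eLpNorm_two_weightedMeasure hw (continuous_gradient φ) fun x hx => gradient_eq_zero φ hx]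
    have e1 : ∀ h : EuclideanSpace ℝ (Fin n) → ℝ≥0∞,
        ∫⁻ x, h x * ENNReal.ofReal (w x) = ∫⁻ x, h x * W x := fun h => by
      refine lintegral_congr_ae ?_
      filter_upwards [hWw] with x hx
      rw [hx]
    rw [e1, e1, ENNReal.mul_comm_div, ← mul_div_assoc, ENNReal.le_div_iff_mul_le
      (Or.inl (pow_ne_zero _ hV0)) (Or.inl (ENNReal.pow_ne_top hVt))]
    exact lintegral_sq_mul_le hW h0 (.of_forall fun _ => ENNReal.ofReal_ne_top) hC' hR hDR he φ
  have h2 := ENNReal.rpow_le_rpow key (by norm_num : (0 : ℝ) ≤ 1 / 2)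
  have e2 : ∀ a : ℝ≥0∞, (a ^ 2) ^ (1 / 2 : ℝ) = a := fun a => by
    rw [← ENNReal.rpow_natCast, ← ENNReal.rpow_mul]
    norm_num
  rwa [ENNReal.mul_rpow_of_nonneg _ _ (by norm_num), e2, e2] at h2

end WeightedSobolev

theorem theorem11 (n : ℕ) (hn : 2 ≤ n)
    (D : TopologicalSpace.Opens (EuclideanSpace ℝ (Fin n)))
    (hD : Bornology.IsBounded (D : Set (EuclideanSpace ℝ (Fin n))))
    (w : EuclideanSpace ℝ (Fin n) → ℝ) (hw : WeightedSobolev.IsWeight w)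
    (hw1 : ContDiffOn ℝ 1 w (D : Set (EuclideanSpace ℝ (Fin n))))
    (hwn : ∫⁻ x in (D : Set (EuclideanSpace ℝ (Fin n))),
      ENNReal.ofReal (w x) ^ (-((n : ℝ) / 2)) < ∞)
    (f : EuclideanSpace ℝ (Fin n) → ℝ)
    (hf : MemLp f 2 (volume.restrict (D : Set (EuclideanSpace ℝ (Fin n))))) :
    (WeightedSobolev.IsMuckenhoupt 2 w →
      (∃ u : EuclideanSpace ℝ (Fin n) → ℝ,
        WeightedSobolev.MemSobolevZero D w u ∧ WeightedSobolev.IsWeakSolution D w f u) ∧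
      ∀ u v : EuclideanSpace ℝ (Fin n) → ℝ,
        WeightedSobolev.MemSobolevZero D w u → WeightedSobolev.IsWeakSolution D w f u →
        WeightedSobolev.MemSobolevZero D w v → WeightedSobolev.IsWeakSolution D w f v →
        u =ᵐ[volume.restrict (D : Set (EuclideanSpace ℝ (Fin n)))] v) ∧
    ((∃ u : EuclideanSpace ℝ (Fin n) → ℝ,
        WeightedSobolev.MemEnergyClosure D w u ∧ WeightedSobolev.IsWeakSolution D w f u) ∧
      ∀ u v : EuclideanSpace ℝ (Fin n) → ℝ,
        WeightedSobolev.MemEnergyClosure D w u → WeightedSobolev.IsWeakSolution D w f u →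
        WeightedSobolev.MemEnergyClosure D w v → WeightedSobolev.IsWeakSolution D w f v →
        u =ᵐ[volume.restrict (D : Set (EuclideanSpace ℝ (Fin n)))] v) := by
  have hE := WeightedSobolev.exists_memEnergyClosure hn hD hw hw1.continuousOn hwn hf
  have hU : ∀ u v : EuclideanSpace ℝ (Fin n) → ℝ,
      WeightedSobolev.MemEnergyClosure D w u → WeightedSobolev.IsWeakSolution D w f u →
      WeightedSobolev.MemEnergyClosure D w v → WeightedSobolev.IsWeakSolution D w f v →
      u =ᵐ[volume.restrict (D : Set (EuclideanSpace ℝ (Fin n)))] v :=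
    fun u v hu hu' hv hv' => WeightedSobolev.ae_eq_of_memEnergyClosure hn hD hw hwn hu hu' hv hv'
  refine ⟨fun hA => ⟨?_, fun u v hu hu' hv hv' => ?_⟩, hE, hU⟩
  · obtain ⟨K, hK⟩ := WeightedSobolev.exists_poincare hn hD hw hA
    obtain ⟨u, hu, hu'⟩ := hE
    exact ⟨u, hu.memSobolevZero hn hD hw hwn hK, hu'⟩
  · exact hU u v (hu.memEnergyClosure hn hD hw hwn) hu' (hv.memEnergyClosure hn hD hw hwn) hv'
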